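/- Fix $\alpha>0$ and $\nu>0$. For $n\in\mathbb N^*$ let $R_n=2\log(n/\nu)$ and, for $n>\nu$, let $X_1^n,\dots,X_n^n$ be independent random points of the Poincaré disc $\mathbb H$ (the open unit disc of $\mathbb C$ with the metric $4|dw|^2/(1-|w|^2)^2$) with common law $\mu_n$, where $\mu_n$ is the law of the point with polar coordinates $(r,\theta)$ ($r$ being the hyperbolic distance to the centre and $\theta$ the angle) such that $r$ and $\theta$ are independent, $\theta$ is uniform on $(-\pi,\pi]$ and $r$ has density $$\rho_n(r)=\frac{\alpha\sinh(\alpha r)}{\cosh(\alpha R_n)-1}\mathbf 1_{\{0\le r<R_n\}}.$$ Write $r(X_i^n)$ for the hyperbolic distance of $X_i^n$ to the centre. For a subspace $E$ of $[-\infty,\infty]$, let $M_p(E)$ be the space of locally finite point measures on $E$ with the vague topology (the coarsest topology making $m\mapsto\int f\,dm$ continuous for all continuous, compactly supported $f\ge 0$ on $E$), and let $\xrightarrow{d}$ denote convergence in distribution (weak convergence of laws) of random elements of $M_p(E)$. For a function $\gamma\ge0$, let $\eta_\gamma$ be the Poisson process on $E$ whose intensity measure has density $\gamma$ with respect to Lebesgue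 measure (with no mass at $-\infty$). As $n\to\infty$: - If $\alpha<1/2$, then $\displaystyle\sum_{i=1}^n\delta_{n^{1/2-\alpha}r(X_i^n)}\xrightarrow{d}\eta_{\gamma_1}$ in $M_p([0,\infty))$, where $\gamma_1(u)=2\alpha^2\nu^{2\alpha}u$. - If $\alpha=1/2$, then $\displaystyle\sum_{i=1}^n\delta_{r(X_i^n)}\xrightarrow{d}\eta_{\gamma_2}$ in $M_p([0,\infty))$, where $\gamma_2(u)=\nu\sinh(u/2)$. - If $\alpha>1/2$, then $\displaystyle\sum_{i=1}^n\delta_{r(X_i^n)-(1-\frac1{2\alpha})R_n}\xrightarrow{d}\eta_{\gamma_3}$ in $M_p([-\infty,\infty))$, where $\gamma_3(u)=\alpha\nu e^{\alpha u}$. -/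

import Mathlib

open MeasureTheory ProbabilityTheory Filter Topology
open scoped CompactlySupported ENNReal NNReal

noncomputable section

/-! ### Point measures, vague topology, Poisson processes -/

/-- `M_p(E)`: the locally finite (i.e. finite on compact sets) point measures on `E`.  A point
measure is a countable sum of Dirac masses, `∑ i, δ_{x i}`. -/
@[ext]
structure PointMeasure (E : Type*) [TopologicalSpace E] [MeasurableSpace E] where
  toMeasure : Measure E
  finite_on_compacts : ∀ K : Set E, IsCompact K → toMeasure K < ∞
  isPoint : ∃ (ι : Type) (_ : Countable ι) (x : ι → E),
    toMeasure = Measure.sum (fun i => Measure.dirac (x i))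

namespace PointMeasure

variable {E : Type*} [TopologicalSpace E] [MeasurableSpace E]

/-- The vague topology on `M_p(E)`: the coarsest topology for which `m ↦ ∫ f dm` is continuous
for every continuous compactly supported `f ≥ 0` on `E`. -/
instance instTopologicalSpace : TopologicalSpace (PointMeasure E) :=
  TopologicalSpace.induced
    (fun (m : PointMeasure E) (f : C_c(E, ℝ≥0)) => ∫ x, (f x : ℝ) ∂m.toMeasure) inferInstance

/-- `M_p(E)` carries the Borel σ-algebra of the vague topology. -/
instance instMeasurableSpace : MeasurableSpace (PointMeasure E) := borel _

instance instBorelSpace : BorelSpace (PointMeasure E) := ⟨rfl⟩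

/-- The point measure `∑ i, δ_{x i}` of a finite family of points, counted with multiplicity. -/
def ofPoints {n : ℕ} (x : Fin n → E) : PointMeasure E where
  toMeasure := ∑ i, Measure.dirac (x i)
  finite_on_compacts K _ := measure_lt_top _ K
  isPoint := ⟨Fin n, inferInstance, x, (Measure.sum_fintype _).symm⟩

end PointMeasure

/-- The random point measure `η`, defined on the probability space `(Ω, P)`, is a Poisson process
on `E` with intensity measure `Λ`: the number of points in a measurable set `B` with `Λ B < ∞` has
the Poisson distribution of parameter `Λ B`, and the numbers of points in finitely many pairwise
disjoint measurable sets are independent. -/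
structure IsPoissonProcess {E : Type*} [TopologicalSpace E] [MeasurableSpace E]
    {Ω : Type*} [MeasurableSpace Ω] (η : Ω → PointMeasure E) (Λ : Measure E) (P : Measure Ω) :
    Prop where
  aemeasurable : AEMeasurable η P
  poisson_count : ∀ B : Set E, MeasurableSet B → Λ B < ∞ →
    HasLaw (fun ω => (η ω).toMeasure B)
      ((poissonMeasure (Λ B).toNNReal).map (fun k : ℕ => (k : ℝ≥0∞))) P
  indep_count : ∀ (k : ℕ) (B : Fin k → Set E), (∀ i, MeasurableSet (B i)) →
    Pairwise (fun i j => Disjoint (B i) (B j)) →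
    iIndepFun (fun i ω => (η ω).toMeasure (B i)) P

/-- The point processes `ξ n`, defined on the probability spaces `(Ω n, P n)`, converge in
distribution in `M_p(E)` (weak convergence of their laws, for the vague topology) to the Poisson
process with intensity measure `Λ`.  This includes that such a Poisson process exists; `Q` ranges
over the laws on `M_p(E)` of Poisson processes with intensity measure `Λ`. -/
def TendstoInDistributionPoisson {E : Type*} [TopologicalSpace E] [MeasurableSpace E]
    {Ω : ℕ → Type*} [∀ n, MeasurableSpace (Ω n)] (ξ : ∀ n, Ω n → PointMeasure E)
    (P : ∀ n, Measure (Ω n)) [∀ n, IsProbabilityMeasure (P n)] (Λ : Measure E) : Prop :=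
  (∃ Q : ProbabilityMeasure (PointMeasure E), IsPoissonProcess id Λ (Q : Measure _)) ∧
  ∀ Q : ProbabilityMeasure (PointMeasure E), IsPoissonProcess id Λ (Q : Measure _) →
    TendstoInDistribution ξ atTop id P (Q : Measure _)

/-! ### The Poincaré disc and the distribution of the nodes -/

namespace RandomHyperbolicGraph

/-- Borel σ-algebra on the open unit disc of `ℂ`. -/
instance instMeasurableSpaceUnitDisc : MeasurableSpace Complex.UnitDisc := borel _

instance instBorelSpaceUnitDisc : BorelSpace Complex.UnitDisc := ⟨rfl⟩

/-- The distance of the Poincaré disc (curvature `-1`, metric `4 |dw|² / (1 - |w|²)²`). -/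
def hypDist (z w : Complex.UnitDisc) : ℝ :=
  2 * Real.arsinh (‖(z : ℂ) - (w : ℂ)‖ /
    √((1 - ‖(z : ℂ)‖ ^ 2) * (1 - ‖(w : ℂ)‖ ^ 2)))

/-- The radius of a point: its hyperbolic distance to the centre of the disc. -/
def radius (w : Complex.UnitDisc) : ℝ := hypDist w 0

theorem radius_nonneg (w : Complex.UnitDisc) : 0 ≤ radius w :=
  mul_nonneg zero_le_two (Real.arsinh_nonneg_iff.2 (by positivity))

/-- The point of the disc with polar coordinates `(r, θ)`: hyperbolic distance `r` to the
centre (for `r ≥ 0`) and angle `θ`. -/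
def ofPolar (p : ℝ × ℝ) : Complex.UnitDisc :=
  Complex.UnitDisc.mk (Real.tanh (p.1 / 2) * Complex.exp (p.2 * Complex.I)) (by
    rw [norm_mul, Complex.norm_exp_ofReal_mul_I, mul_one, Complex.norm_real, Real.norm_eq_abs]
    exact Real.abs_tanh_lt_one _)

/-- The radius `R_n = 2 log (n / ν)` of the model. -/
def diskRadius (ν : ℝ) (n : ℕ) : ℝ := 2 * Real.log (n / ν)

/-- The density `ρ_n` of the radius of a node. -/
def radialDensity (α ν : ℝ) (n : ℕ) (r : ℝ) : ℝ :=
  if 0 ≤ r ∧ r < diskRadius ν n then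
    α * Real.sinh (α * r) / (Real.cosh (α * diskRadius ν n) - 1) else 0

/-- The distribution `μ_n` of a node: in polar coordinates `(r, θ)`, the radius `r` and the angle
`θ` are independent, `r` has density `ρ_n` and `θ` is uniform on `(-π, π]`. -/
def nodeMeasure (α ν : ℝ) (n : ℕ) : Measure Complex.UnitDisc :=
  (((volume : Measure ℝ).withDensity (fun r => ENNReal.ofReal (radialDensity α ν n r))).prod
    (ProbabilityTheory.cond (volume : Measure ℝ) (Set.Ioc (-Real.pi) Real.pi))).map ofPolar

/-! ### Limiting intensity measures -/

/-- The measure with density `γ` (with respect to Lebesgue measure) on `[0, ∞)`. -/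
def intensityIci (γ : ℝ → ℝ) : Measure (Set.Ici (0 : ℝ)) :=
  ((volume : Measure ℝ).comap Subtype.val).withDensity (fun u => ENNReal.ofReal (γ u))

/-- The inclusion of `ℝ` in the subspace `[-∞, ∞)` of the compactified real line. -/
def toIio (u : ℝ) : Set.Iio (⊤ : EReal) := ⟨(u : EReal), EReal.coe_lt_top u⟩

/-- The measure with density `γ` (with respect to Lebesgue measure) on `[-∞, ∞)` (with no mass at `-∞`). -/
def intensityIio (γ : ℝ → ℝ) : Measure (Set.Iio (⊤ : EReal)) :=
  ((volume : Measure ℝ).withDensity (fun u => ENNReal.ofReal (γ u))).map toIio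

end RandomHyperbolicGraph

end

/-! The argument is Poisson convergence by characteristic functionals. For `n` independent points
with law `μ n`, the functional at `g` is `(1 + ∫ (e^{ig} - 1) dμ n)^n`. When `g` is continuous with
compact support, so is `e^{ig} - 1`. Hence convergence of `n ∫ h dμ n` to `∫ h dΛ` for all such
complex `h` gives the limit `exp (∫ (e^{ig} - 1) dΛ)`, the functional of the Poisson process
(`IsPoissonProcess.integral_exp`).

Convergence of these functionals implies weak convergence
(`PointMeasure.tendsto_of_tendsto_integral_exp`). The vague topology is induced by countably many
integrals, so every open set is an increasing union of finite-dimensional open cylinders, on which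
Lévy's continuity theorem and the portmanteau inequality apply. Since the limit law is given, no
tightness argument is needed. The limit law exists by superposing, over the cells of a compact
exhaustion, Poisson numbers of independent points (`exists_isPoissonProcess`).

What remains is analysis of the radial density. Since `n = ν e^{R/2}` and `cosh (αR) - 1 ~ e^{αR} /
2`, `n` times the density at `r` is close to `2αν e^{(1/2-α)R} sinh (αr)`. For `α = 1/2` this is
already `ν sinh (r/2)`. For `α < 1/2` the prefactor grows; stretching radii by `c = n^{1/2-α}` turns
it into `2αν^{2α} c sinh (αu/c)`, which tends to `2α²ν^{2α} u`. For `α > 1/2` it decays, and the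
shift `b = (1 - 1/(2α)) R`, for which `αb = (α - 1/2) R`, restores the balance and leaves `αν
e^{αu}`. Dominated convergence then gives the vague convergence; in the last case compact sets may
reach `-∞`, and integrability of `e^{αu}` there prevents any loss of mass. -/

namespace PointMeasure

variable {E : Type*} [TopologicalSpace E] [MeasurableSpace E]

instance isFiniteMeasureOnCompacts (m : PointMeasure E) :
    IsFiniteMeasureOnCompacts m.toMeasure :=
  ⟨fun _ hK => m.finite_on_compacts _ hK⟩

theorem continuous_integral (f : C_c(E, ℝ≥0)) :
    Continuous fun m : PointMeasure E => ∫ x, (f x : ℝ) ∂m.toMeasure :=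
  (continuous_apply f).comp (continuous_induced_dom (f := fun (m : PointMeasure E)
    (f : C_c(E, ℝ≥0)) => ∫ x, (f x : ℝ) ∂m.toMeasure))

end PointMeasure

/-! ### Test functions and countable generation of the vague topology -/

theorem CompactlySupportedContinuousMap.exists_one_on_isCompact {E : Type*} [TopologicalSpace E]
    [T2Space E] [LocallyCompactSpace E] {K : Set E} (hK : IsCompact K) :
    ∃ h : C_c(E, ℝ≥0), (∀ x ∈ K, h x = 1) ∧ ∀ x, h x ≤ 1 := by
  obtain ⟨f, hf1, hfc, -, hf01⟩ :=
    exists_continuousMap_one_of_isCompact_subset_isOpen hK isOpen_univ (Set.subset_univ K)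
  refine ⟨⟨⟨fun x => (f x).toNNReal, by fun_prop⟩, ?_⟩, fun x hx => ?_, fun x => ?_⟩
  · exact HasCompactSupport.comp_left (g := Real.toNNReal) hfc (by simp)
  · have : f x = 1 := hf1 hx
    change (f x).toNNReal = 1
    simp [this]
  · change (f x).toNNReal ≤ 1
    simpa using (hf01 x).2

section Approximation

variable {E : Type*} [TopologicalSpace E] [LocallyCompactSpace E] [SecondCountableTopology E]

/-- Functions supported in a fixed compact set `K` admit a countable uniformly dense family. -/
theorem CompactlySupportedContinuousMap.exists_dense_seq_of_tsupport_subset (K : Set E)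
    (hK : IsCompact K) :
    ∃ d : ℕ → C_c(E, ℝ≥0), (∀ k, ∀ x ∉ K, d k x = 0) ∧
      ∀ f : C_c(E, ℝ≥0), (∀ x ∉ K, f x = 0) → ∀ ε : ℝ, 0 < ε →
        ∃ k, ∀ x, |(f x : ℝ) - d k x| ≤ K.indicator (fun _ => ε) x := by
  -- The compact-open topology on `C(E, ℝ≥0)` is second countable, so `A` is separable; closeness in
  -- it, restricted to `K`, is uniform closeness on `K`.
  let A : Set C(E, ℝ≥0) := {g | ∃ f : C_c(E, ℝ≥0), (∀ x ∉ K, f x = 0) ∧ f.toContinuousMap = g}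
  have hA : Nonempty A := ⟨⟨_, 0, fun _ _ => rfl, rfl⟩⟩
  choose d hd0 hd using fun k => (TopologicalSpace.denseSeq A k).2
  refine ⟨d, hd0, fun f hf ε hε => ?_⟩
  have : CompactSpace K := isCompact_iff_compactSpace.1 hK
  have ho : IsOpen {g : A | dist ((g : C(E, ℝ≥0)).restrict K) (f.toContinuousMap.restrict K) < ε} :=
    isOpen_lt (((ContinuousMap.continuous_restrict K).comp continuous_subtype_val).dist
      continuous_const) continuous_const
  obtain ⟨k, hk⟩ := (TopologicalSpace.denseRange_denseSeq A).exists_mem_open ho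
    ⟨⟨_, f, hf, rfl⟩, by simpa using hε⟩
  refine ⟨k, fun x => ?_⟩
  by_cases hx : x ∈ K
  · rw [Set.indicator_of_mem hx]
    have h1 := (ContinuousMap.dist_apply_le_dist (⟨x, hx⟩ : K)).trans_lt hk
    rw [← hd k, dist_comm] at h1
    exact h1.le
  · simp [hx, hf x hx, hd0 k x hx]

end Approximation

namespace PointMeasure

variable {E : Type*} [TopologicalSpace E] [MeasurableSpace E]

section

variable [OpensMeasurableSpace E]

theorem integrable_coe (m : PointMeasure E) (f : C_c(E, ℝ≥0)) :
    Integrable (fun x => (f x : ℝ)) m.toMeasure :=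
  (NNReal.continuous_coe.comp f.continuous).integrable_of_hasCompactSupport
    (f.hasCompactSupport.comp_left (g := NNReal.toReal) rfl)

theorem abs_integral_sub_le (m : PointMeasure E) (f g h : C_c(E, ℝ≥0)) (ε : ℝ)
    (hfg : ∀ x, |(f x : ℝ) - g x| ≤ ε * h x) :
    |∫ x, (f x : ℝ) ∂m.toMeasure - ∫ x, (g x : ℝ) ∂m.toMeasure|
      ≤ ε * ∫ x, (h x : ℝ) ∂m.toMeasure := by
  rw [← integral_sub (m.integrable_coe f) (m.integrable_coe g), ← integral_const_mul]
  exact (abs_integral_le_integral_abs).trans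
    (integral_mono ((m.integrable_coe f).sub (m.integrable_coe g)).abs
      ((m.integrable_coe h).const_mul ε) hfg)

end

variable [T2Space E] [LocallyCompactSpace E] [SecondCountableTopology E] [BorelSpace E]

/-- The vague topology is generated by the integrals of countably many functions. -/
theorem exists_seq_topology_eq_induced (E : Type*) [TopologicalSpace E] [MeasurableSpace E]
    [T2Space E] [LocallyCompactSpace E] [SecondCountableTopology E] [BorelSpace E] :
    ∃ d : ℕ → C_c(E, ℝ≥0), (instTopologicalSpace : TopologicalSpace (PointMeasure E)) =
      TopologicalSpace.induced (fun m k => ∫ x, (d k x : ℝ) ∂m.toMeasure) inferInstance := by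
  let K := CompactExhaustion.choice E
  choose d hd0 hd using fun n =>
    CompactlySupportedContinuousMap.exists_dense_seq_of_tsupport_subset (K n) (K.isCompact n)
  choose h h1 hle using fun n =>
    CompactlySupportedContinuousMap.exists_one_on_isCompact (K.isCompact n)
  -- The cutoffs `h n` join the dense families because they bound the mass of `K n` for `m` near
  -- `m₀`; without this, uniform closeness of test functions would not control integrals.
  let D : (ℕ × ℕ) ⊕ ℕ → C_c(E, ℝ≥0) := Sum.elim (fun p => d p.1 p.2) h
  obtain ⟨e⟩ : Nonempty (ℕ ≃ (ℕ × ℕ) ⊕ ℕ) := nonempty_equiv_of_countable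
  refine ⟨fun k => D (e k), le_antisymm ?_ ?_⟩
  · rw [← continuous_iff_le_induced]
    exact continuous_pi fun k => continuous_integral _
  · rw [instTopologicalSpace, ← continuous_iff_le_induced]
    let _ : TopologicalSpace (PointMeasure E) :=
      TopologicalSpace.induced (fun m k => ∫ x, (D (e k) x : ℝ) ∂m.toMeasure) inferInstance
    have hD : ∀ i, Continuous fun m : PointMeasure E => ∫ x, (D i x : ℝ) ∂m.toMeasure := by
      intro i
      have : Continuous fun m : PointMeasure E => ∫ x, (D (e (e.symm i)) x : ℝ) ∂m.toMeasure :=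
        (continuous_apply (e.symm i)).comp
          (continuous_induced_dom (f := fun (m : PointMeasure E) k =>
            ∫ x, (D (e k) x : ℝ) ∂m.toMeasure))
      simpa using this
    refine continuous_pi fun f => continuous_iff_continuousAt.2 fun m₀ => ?_
    obtain ⟨n, hn⟩ := K.exists_superset_of_isCompact f.hasCompactSupport
    have hf : ∀ x ∉ K n, f x = 0 := fun x hx => image_eq_zero_of_notMem_tsupport fun h => hx (hn h)
    rw [ContinuousAt, Metric.tendsto_nhds]
    intro ε hε
    set a := ∫ x, (h n x : ℝ) ∂m₀.toMeasure with ha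
    have ha0 : 0 ≤ a := integral_nonneg fun x => NNReal.coe_nonneg _
    -- Replacing `f` by `d n k` costs at most `δ (a + 1) = ε / 4` at `m` and at `m₀`, leaving `ε /
    -- 2` for the variation of the integral of `d n k`.
    set δ := ε / (4 * (a + 1)) with hδ
    have hδ0 : 0 < δ := by positivity
    obtain ⟨k, hk⟩ := hd n f hf δ hδ0
    have hk' : ∀ x, |(f x : ℝ) - d n k x| ≤ δ * h n x := by
      intro x
      refine (hk x).trans ?_
      by_cases hx : x ∈ K n
      · simp [hx, h1 n x hx]
      · simp only [hx, not_false_eq_true, Set.indicator_of_notMem]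
        positivity
    have e1 := (hD (Sum.inr n)).continuousAt.eventually_lt (x₀ := m₀)
      (continuousAt_const (y := a + 1)) (by simp [D, ← ha])
    have e2 := Metric.tendsto_nhds.1 ((hD (Sum.inl (n, k))).continuousAt (x := m₀)) (ε / 2)
      (by positivity)
    filter_upwards [e1, e2] with m hm1 hm2
    simp only [D, Sum.elim_inr, Sum.elim_inl, Real.dist_eq] at hm1 hm2 ⊢
    have b1 := m.abs_integral_sub_le f (d n k) (h n) δ hk'
    have b2 := m₀.abs_integral_sub_le f (d n k) (h n) δ hk'
    have b3 : δ * ∫ x, (h n x : ℝ) ∂m.toMeasure ≤ δ * (a + 1) := by gcongr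
    have b4 : δ * a ≤ δ * (a + 1) := by gcongr; linarith
    have b5 : δ * (a + 1) = ε / 4 := by rw [hδ]; field_simp
    rw [← ha] at b2
    have b6 := abs_le.1 (b1.trans b3)
    have b7 := abs_le.1 (b2.trans b4)
    have b8 := abs_lt.1 hm2
    rw [abs_lt]
    constructor <;> linarith [b6.1, b6.2, b7.1, b7.2, b8.1, b8.2]

/-- A map into `M_p(E)` is measurable as soon as its integrals against test functions are. -/
theorem measurable_of_measurable_integral {Ω : Type*} [MeasurableSpace Ω] {η : Ω → PointMeasure E}
    (h : ∀ f : C_c(E, ℝ≥0), Measurable fun ω => ∫ x, (f x : ℝ) ∂(η ω).toMeasure) :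
    Measurable η := by
  obtain ⟨d, hd⟩ := exists_seq_topology_eq_induced E
  -- Countability is essential here: on `ℕ → ℝ` the Borel σ-algebra is the product one.
  have : (instMeasurableSpace : MeasurableSpace (PointMeasure E)) =
      MeasurableSpace.comap (fun m k => ∫ x, (d k x : ℝ) ∂m.toMeasure) MeasurableSpace.pi := by
    rw [BorelSpace.measurable_eq (α := ℕ → ℝ), ← borel_comap, ← hd]
    rfl
  rw [this, measurable_comap_iff]
  exact measurable_pi_lambda _ fun k => h (d k)

/-! ### Measurability of counts -/

theorem measurable_apply_isCompact {K : Set E} (hK : IsCompact K) :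
    Measurable fun m : PointMeasure E => m.toMeasure K := by
  obtain ⟨h, h1, hle⟩ := CompactlySupportedContinuousMap.exists_one_on_isCompact hK
  -- Continuous approximations of the indicator of `K`; the factor `h` gives them compact support
  -- and an integrable majorant.
  let f : ℕ → C_c(E, ℝ≥0) := fun n =>
    ⟨⟨fun x => hK.isClosed.apprSeq n x * h x, by fun_prop⟩, h.hasCompactSupport.mul_left⟩
  have hf : ∀ n x, f n x = hK.isClosed.apprSeq n x * h x := fun _ _ => rfl
  have hlim : ∀ x, Tendsto (fun n => f n x) atTop (𝓝 (K.indicator 1 x)) := by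
    intro x
    have := (tendsto_pi_nhds.1 (HasOuterApproxClosed.tendsto_apprSeq hK.isClosed) x).mul_const (h x)
    simp_rw [hf]
    convert this using 2
    by_cases hx : x ∈ K
    · simp [hx, h1]
    · simp [hx]
  have hm : Measurable fun m : PointMeasure E => m.toMeasure.real K := by
    refine measurable_of_tendsto_metrizable (fun n => (continuous_integral (f n)).measurable)
      (tendsto_pi_nhds.2 fun m => ?_)
    have : m.toMeasure.real K = ∫ x, ((K.indicator 1 x : ℝ≥0) : ℝ) ∂m.toMeasure := by
      rw [← integral_indicator_one hK.measurableSet]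
      congr 1 with x
      by_cases hx : x ∈ K <;> simp [hx]
    rw [this]
    refine tendsto_integral_of_dominated_convergence (fun x => (h x : ℝ))
      (fun n => (m.integrable_coe (f n)).aestronglyMeasurable) (m.integrable_coe h)
      (fun n => ae_of_all _ fun x => ?_) (ae_of_all _ fun x => ?_)
    · rw [Real.norm_of_nonneg (NNReal.coe_nonneg _), NNReal.coe_le_coe, hf]
      exact mul_le_of_le_one_left' (HasOuterApproxClosed.apprSeq_apply_le_one _ _ _)
    · exact (NNReal.continuous_coe.tendsto _).comp (hlim x)
  have : (fun m : PointMeasure E => m.toMeasure K) =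
      fun m => ENNReal.ofReal (m.toMeasure.real K) := by
    ext m
    rw [measureReal_def, ENNReal.ofReal_toReal (m.finite_on_compacts K hK).ne]
  rw [this]
  exact hm.ennreal_ofReal

theorem iSup_measure_inter_compactExhaustion {E : Type*} [TopologicalSpace E] [MeasurableSpace E]
    (K : CompactExhaustion E) (μ : Measure E) (B : Set E) : ⨆ n, μ (B ∩ K n) = μ B := by
  have hmono : Monotone fun n => B ∩ K n :=
    fun i j hij => Set.inter_subset_inter_right B (K.subset hij)
  rw [← hmono.measure_iUnion, ← Set.inter_iUnion, K.iUnion_eq, Set.inter_univ]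

theorem measurable_apply {B : Set E} (hB : MeasurableSet B) :
    Measurable fun m : PointMeasure E => m.toMeasure B := by
  let K := CompactExhaustion.choice E
  -- On `K n` the measures are finite, so the π-system of closed sets decides measurability.
  have key : ∀ n, Measurable fun m : PointMeasure E => m.toMeasure.restrict (K n) := by
    intro n
    have : ∀ m : PointMeasure E, IsFiniteMeasure (m.toMeasure.restrict (K n)) :=
      fun m => ⟨by simpa using m.finite_on_compacts _ (K.isCompact n)⟩
    have hcl : ∀ s, IsClosed s →
        Measurable fun m : PointMeasure E => m.toMeasure.restrict (K n) s := by
      intro s hs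
      simp_rw [Measure.restrict_apply hs.measurableSet]
      exact measurable_apply_isCompact ((K.isCompact n).inter_left hs)
    exact Measurable.measure_of_isPiSystem
      ((BorelSpace.measurable_eq (α := E)).trans borel_eq_generateFrom_isClosed)
      isPiSystem_isClosed hcl (hcl _ isClosed_univ)
  simp_rw [← fun m : PointMeasure E => iSup_measure_inter_compactExhaustion K m.toMeasure B]
  refine Measurable.iSup fun n => ?_
  have := (Measure.measurable_coe hB).comp (key n)
  simpa [Function.comp_def, Measure.restrict_apply hB] using this

theorem measurable_ofPoints {n : ℕ} :
    Measurable (ofPoints : (Fin n → E) → PointMeasure E) := by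
  refine measurable_of_measurable_integral fun f => ?_
  have : ∀ x : Fin n → E, ∫ y, (f y : ℝ) ∂(ofPoints x).toMeasure = ∑ i, (f (x i) : ℝ) := by
    intro x
    rw [ofPoints, integral_finsetSum_measure fun i _ => integrable_dirac (by simp)]
    simp
  simp_rw [this]
  have hf : Measurable f := f.continuous.measurable
  fun_prop

end PointMeasure

/-! ### Weak convergence from characteristic functionals -/

namespace PointMeasure

variable {E : Type*} [TopologicalSpace E] [MeasurableSpace E]
  [T2Space E] [LocallyCompactSpace E] [SecondCountableTopology E] [BorelSpace E]

/-- The integrals of the first `k` functions of a sequence, as a vector. -/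
noncomputable def integralVector (d : ℕ → C_c(E, ℝ≥0)) (k : ℕ) (m : PointMeasure E) :
    EuclideanSpace ℝ (Fin k) :=
  WithLp.toLp 2 fun i => ∫ x, (d i x : ℝ) ∂m.toMeasure

omit [T2Space E] [LocallyCompactSpace E] [SecondCountableTopology E] [BorelSpace E] in
theorem continuous_integralVector (d : ℕ → C_c(E, ℝ≥0)) (k : ℕ) :
    Continuous (integralVector d k) :=
  (PiLp.continuous_toLp 2 _).comp (continuous_pi fun i => continuous_integral (d i))

omit [T2Space E] [LocallyCompactSpace E] [SecondCountableTopology E] in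
theorem inner_integralVector (d : ℕ → C_c(E, ℝ≥0)) (k : ℕ) (m : PointMeasure E)
    (t : EuclideanSpace ℝ (Fin k)) :
    inner ℝ (integralVector d k m) t = ∫ x, ∑ i, t i * (d i x : ℝ) ∂m.toMeasure := by
  rw [integral_finsetSum Finset.univ (f := fun (i : Fin k) x => t i * (d i x : ℝ))
    fun i _ => (m.integrable_coe (d i)).const_mul _]
  simp [integralVector, PiLp.inner_apply, integral_const_mul]

omit [T2Space E] [LocallyCompactSpace E] [SecondCountableTopology E] in
-- The inner product with `t` is the integral of the single test function `∑ t i * d i`, so the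
-- hypothesis gives pointwise convergence of characteristic functions, and Lévy's theorem applies.
theorem tendsto_map_integralVector {μ : ℕ → ProbabilityMeasure (PointMeasure E)}
    {μ₀ : ProbabilityMeasure (PointMeasure E)}
    (h : ∀ g : E → ℝ, Continuous g → HasCompactSupport g →
      Tendsto (fun n => ∫ m, Complex.exp ((∫ x, g x ∂m.toMeasure : ℝ) * Complex.I) ∂(μ n).toMeasure)
        atTop (𝓝 (∫ m, Complex.exp ((∫ x, g x ∂m.toMeasure : ℝ) * Complex.I) ∂μ₀.toMeasure)))
    (d : ℕ → C_c(E, ℝ≥0)) (k : ℕ) :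
    Tendsto (fun n => (μ n).map (continuous_integralVector d k).measurable.aemeasurable) atTop
      (𝓝 (μ₀.map (continuous_integralVector d k).measurable.aemeasurable)) := by
  refine ProbabilityMeasure.tendsto_of_tendsto_charFun fun t => ?_
  have hcf : ∀ ν : ProbabilityMeasure (PointMeasure E),
      charFun (ν.map (continuous_integralVector d k).measurable.aemeasurable).toMeasure t =
        ∫ m, Complex.exp ((∫ x, ∑ i, t i * (d i x : ℝ) ∂m.toMeasure : ℝ) * Complex.I)
          ∂ν.toMeasure := by
    intro ν
    rw [ProbabilityMeasure.toMeasure_map, charFun_apply,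
      integral_map (continuous_integralVector d k).measurable.aemeasurable (by fun_prop)]
    simp_rw [inner_integralVector]
  simp_rw [hcf]
  refine h _ (by fun_prop) ?_
  have : HasCompactSupport (∑ i : Fin k, fun x => t i * (d i x : ℝ)) := by
    refine Finset.sum_induction _ (fun f : E → ℝ => HasCompactSupport f)
      (fun _ _ => HasCompactSupport.add) HasCompactSupport.zero fun i _ => ?_
    exact ((d i).hasCompactSupport.comp_left (g := fun y : ℝ≥0 => t i * (y : ℝ)) (by simp))
  convert this
  simp

/-- Convergence of the characteristic functionals implies weak convergence. -/
theorem tendsto_of_tendsto_integral_exp {μ : ℕ → ProbabilityMeasure (PointMeasure E)}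
    {μ₀ : ProbabilityMeasure (PointMeasure E)}
    (h : ∀ g : E → ℝ, Continuous g → HasCompactSupport g →
      Tendsto (fun n => ∫ m, Complex.exp ((∫ x, g x ∂m.toMeasure : ℝ) * Complex.I) ∂(μ n).toMeasure)
        atTop (𝓝 (∫ m, Complex.exp ((∫ x, g x ∂m.toMeasure : ℝ) * Complex.I) ∂μ₀.toMeasure))) :
    Tendsto μ atTop (𝓝 μ₀) := by
  obtain ⟨d, hd⟩ := exists_seq_topology_eq_induced E
  refine tendsto_of_forall_isOpen_le_liminf' fun G hG => ?_
  -- The largest open set whose cylinder lies in `G`. Maximality makes the cylinders increase with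
  -- `k`, a cylinder over `k` coordinates being also one over `k + 1`.
  let O : ∀ k, Set (EuclideanSpace ℝ (Fin k)) := fun k =>
    ⋃₀ {U | IsOpen U ∧ integralVector d k ⁻¹' U ⊆ G}
  have hO : ∀ k, IsOpen (O k) := fun k => isOpen_sUnion fun U hU => hU.1
  have hOG : ∀ k, integralVector d k ⁻¹' O k ⊆ G := by
    rintro k m ⟨U, hU, hm⟩
    exact hU.2 hm
  have hmono : Monotone fun k => integralVector d k ⁻¹' O k := by
    refine monotone_nat_of_le_succ fun k m hm => ?_
    let π : EuclideanSpace ℝ (Fin (k + 1)) → EuclideanSpace ℝ (Fin k) :=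
      fun y => WithLp.toLp 2 fun i => y i.castSucc
    have hπ : Continuous π := by fun_prop
    exact ⟨π ⁻¹' O k, ⟨(hO k).preimage hπ, fun m' hm' => hOG k hm'⟩, hm⟩
  have hunion : ⋃ k, integralVector d k ⁻¹' O k = G := by
    refine Set.Subset.antisymm (Set.iUnion_subset hOG) fun m hm => ?_
    rw [hd, isOpen_induced_iff] at hG
    obtain ⟨V, hV, rfl⟩ := hG
    obtain ⟨I, u, hu, hsub⟩ := isOpen_pi_iff.1 hV _ hm
    -- A basic neighbourhood constrains only the coordinates in the finite set `I`, all below `I.sup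
    -- id + 1`.
    refine Set.mem_iUnion.2 ⟨I.sup id + 1, {y | ∀ i : Fin (I.sup id + 1), (i : ℕ) ∈ I → y i ∈ u i},
      ⟨?_, fun m' hm' => hsub fun i hi => ?_⟩, fun i hi => (hu i hi).2⟩
    · simp only [Set.ofPred_forall]
      refine isOpen_iInter_of_finite fun i => isOpen_iInter_of_finite fun hi => ?_
      exact (hu i hi).1.preimage (by fun_prop)
    · exact hm' ⟨i, Nat.lt_succ_of_le (Finset.le_sup (f := id) hi)⟩ hi
  rw [← hunion, hmono.measure_iUnion]
  refine iSup_le fun k => ?_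
  have hk := ProbabilityMeasure.le_liminf_measure_open_of_tendsto
    (tendsto_map_integralVector h d k) (hO k)
  have hmeas : ∀ ν : ProbabilityMeasure (PointMeasure E),
      (ν.map (continuous_integralVector d k).measurable.aemeasurable).toMeasure (O k) =
        ν.toMeasure (integralVector d k ⁻¹' O k) := fun ν => by
    rw [ProbabilityMeasure.toMeasure_map,
      Measure.map_apply (continuous_integralVector d k).measurable (hO k).measurableSet]
  simp_rw [hmeas] at hk
  refine hk.trans (liminf_le_liminf (Eventually.of_forall fun n => measure_mono ?_))
  rw [hunion]
  exact hOG k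

end PointMeasure

/-! ### The characteristic functional of a Poisson process -/

theorem MeasureTheory.SimpleFunc.integral_comp_eq_sum_inter {E G : Type*} [MeasurableSpace E]
    [NormedAddCommGroup G] [NormedSpace ℝ G] [CompleteSpace G] (s : SimpleFunc E ℝ) {K : Set E}
    (hs : ∀ x ∉ K, s x = 0) {μ : Measure E} (hμ : μ K < ∞) {F : ℝ → G}
    (hF : F 0 = 0) :
    ∫ x, F (s x) ∂μ = ∑ y ∈ s.range, μ.real (s ⁻¹' {y} ∩ K) • F y := by
  have : IsFiniteMeasure (μ.restrict K) := ⟨by simpa using hμ⟩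
  -- The fibre over `0` may have infinite measure; since `F 0 = 0`, everything can be cut down to
  -- `K`.
  rw [← setIntegral_eq_integral_of_forall_compl_eq_zero (s := K) fun x hx => by rw [hs x hx, hF]]
  have h := SimpleFunc.map_integral s F (μ := μ.restrict K)
    (SimpleFunc.integrable_of_isFiniteMeasure s) hF
  rw [SimpleFunc.integral_eq_integral _ (SimpleFunc.integrable_of_isFiniteMeasure _)] at h
  simp only [SimpleFunc.coe_map, Function.comp_apply] at h
  rw [h]
  refine Finset.sum_congr rfl fun y _ => ?_
  rw [measureReal_restrict_apply (s.measurableSet_fiber y)]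

theorem norm_exp_ofReal_mul_I_sub_one_le (x : ℝ) : ‖Complex.exp (x * Complex.I) - 1‖ ≤ |x| := by
  simpa [mul_comm] using Real.norm_exp_I_mul_ofReal_sub_one_le (x := x)

theorem PointMeasure.continuous_integral_of_hasCompactSupport {E : Type*} [TopologicalSpace E]
    [MeasurableSpace E] [OpensMeasurableSpace E] {g : E → ℝ} (hg : Continuous g)
    (hgc : HasCompactSupport g) :
    Continuous fun m : PointMeasure E => ∫ x, g x ∂m.toMeasure := by
  let p : C_c(E, ℝ≥0) := ⟨⟨fun x => (g x).toNNReal, by fun_prop⟩,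
    hgc.comp_left (g := Real.toNNReal) (by simp)⟩
  let q : C_c(E, ℝ≥0) := ⟨⟨fun x => (-g x).toNNReal, by fun_prop⟩,
    hgc.comp_left (g := fun z : ℝ => (-z).toNNReal) (by simp)⟩
  convert (continuous_integral p).sub (continuous_integral q) using 2 with m
  simp only [Pi.sub_apply]
  rw [← integral_sub (m.integrable_coe p) (m.integrable_coe q)]
  congr 1 with x
  change g x = max (g x) 0 - max (-g x) 0
  grind

namespace IsPoissonProcess

variable {E : Type*} [TopologicalSpace E] [MeasurableSpace E]
  [T2Space E] [LocallyCompactSpace E] [SecondCountableTopology E] [BorelSpace E]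

omit [T2Space E] [LocallyCompactSpace E] [SecondCountableTopology E] [BorelSpace E] in
theorem integral_exp_count {Λ : Measure E} {Q : Measure (PointMeasure E)}
    (hQ : IsPoissonProcess id Λ Q) {B : Set E} (hB : MeasurableSet B) (hΛ : Λ B < ∞) (y : ℝ) :
    ∫ m, Complex.exp ((m.toMeasure.real B * y : ℝ) * Complex.I) ∂Q =
      Complex.exp (Λ.real B * (Complex.exp (y * Complex.I) - 1)) := by
  have h1 := hQ.poisson_count B hB hΛ
  have h2 := h1.integral_comp (f := fun c : ℝ≥0∞ => Complex.exp ((c.toReal * y : ℝ) * Complex.I))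
    (by fun_prop)
  simp only [Function.comp_def, id] at h2
  simp only [measureReal_def]
  rw [h2, integral_map .of_discrete (by fun_prop)]
  have h3 := charFun_map_cast_poissonMeasure (Λ B).toNNReal y
  rw [charFun_apply_real, integral_map .of_discrete (by fun_prop)] at h3
  convert h3 using 3 with k
  · push_cast
    simp [mul_comm]
  · rfl

/-- The integral of `s` is a linear combination of the counts in its disjoint level sets inside `K`.
These are independent Poisson variables, so the expectation factorizes. -/
theorem integral_exp_simpleFunc {Λ : Measure E} {Q : Measure (PointMeasure E)}
    (hQ : IsPoissonProcess id Λ Q) (s : SimpleFunc E ℝ) {K : Set E} (hK : IsCompact K)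
    (hΛ : Λ K < ∞) (hs : ∀ x ∉ K, s x = 0) :
    ∫ m, Complex.exp ((∫ x, s x ∂m.toMeasure : ℝ) * Complex.I) ∂Q =
      Complex.exp (∫ x, (Complex.exp (s x * Complex.I) - 1) ∂Λ) := by
  let e := s.range.equivFin
  let y : Fin s.range.card → ℝ := fun i => (e.symm i : ℝ)
  let B : Fin s.range.card → Set E := fun i => s ⁻¹' {y i} ∩ K
  have hsum : ∀ {G : Type} [AddCommGroup G] (f : ℝ → G), ∑ z ∈ s.range, f z = ∑ i, f (y i) := by
    intro G _ f
    rw [← Finset.sum_coe_sort, ← Equiv.sum_comp e.symm]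
  have hB : ∀ i, MeasurableSet (B i) := fun i => (s.measurableSet_fiber _).inter hK.measurableSet
  have hdisj : Pairwise fun i j => Disjoint (B i) (B j) := by
    intro i j hij
    refine Set.disjoint_left.2 fun x hx hx' => hij ?_
    exact e.symm.injective (Subtype.ext (hx.1.symm.trans hx'.1))
  have hind := hQ.indep_count _ B hB hdisj
  have h1 : ∀ m : PointMeasure E, Complex.exp ((∫ x, s x ∂m.toMeasure : ℝ) * Complex.I) =
      ∏ i, Complex.exp (((m.toMeasure (B i)).toReal * y i : ℝ) * Complex.I) := by
    intro m
    have := s.integral_comp_eq_sum_inter hs (m.finite_on_compacts K hK)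
      (F := fun z => z) rfl
    rw [this, hsum, ← Complex.exp_sum, Complex.ofReal_sum, Finset.sum_mul]
    rfl
  have h2 := hind.integral_fun_prod_comp (f := fun i (c : ℝ≥0∞) =>
      Complex.exp ((c.toReal * y i : ℝ) * Complex.I))
    (fun i => (PointMeasure.measurable_apply (hB i)).aemeasurable) (fun i => by fun_prop)
  simp only [id] at h2
  simp_rw [h1]
  rw [h2, s.integral_comp_eq_sum_inter hs hΛ
    (F := fun z : ℝ => Complex.exp (z * Complex.I) - 1) (by simp), hsum, Complex.exp_sum]
  refine Finset.prod_congr rfl fun i _ => ?_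
  have := hQ.integral_exp_count (hB i) ((measure_mono Set.inter_subset_right).trans_lt hΛ) (y i)
  simp only [measureReal_def, Complex.real_smul] at this ⊢
  rw [this]

/-- The characteristic functional of a Poisson process. -/
theorem integral_exp {Λ : Measure E} [IsFiniteMeasureOnCompacts Λ] {Q : Measure (PointMeasure E)}
    [IsProbabilityMeasure Q]
    (hQ : IsPoissonProcess id Λ Q) {g : E → ℝ} (hg : Continuous g) (hgc : HasCompactSupport g) :
    ∫ m, Complex.exp ((∫ x, g x ∂m.toMeasure : ℝ) * Complex.I) ∂Q =
      Complex.exp (∫ x, (Complex.exp (g x * Complex.I) - 1) ∂Λ) := by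
  -- These approximations are bounded by `2 |g|`, hence vanish off the support of `g`. As `2 |g|` is
  -- integrable for `Λ` and every point measure, dominated convergence applies on both sides.
  let s : ℕ → SimpleFunc E ℝ :=
    SimpleFunc.approxOn g hg.measurable Set.univ 0 (Set.mem_univ 0)
  have hbound : ∀ n x, ‖s n x‖ ≤ ‖g x‖ + ‖g x‖ := fun n x =>
    SimpleFunc.norm_approxOn_zero_le hg.measurable (Set.mem_univ 0) x n
  have hlim : ∀ x, Tendsto (fun n => s n x) atTop (𝓝 (g x)) := fun x =>
    SimpleFunc.tendsto_approxOn hg.measurable (Set.mem_univ 0) (by simp)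
  have hs : ∀ n, ∀ x ∉ tsupport g, s n x = 0 := by
    intro n x hx
    simpa [image_eq_zero_of_notMem_tsupport hx] using hbound n x
  have hint : ∀ (μ : Measure E) [IsFiniteMeasureOnCompacts μ],
      Integrable (fun x => ‖g x‖ + ‖g x‖) μ := fun μ _ =>
    (hg.integrable_of_hasCompactSupport hgc).norm.add (hg.integrable_of_hasCompactSupport hgc).norm
  have hm : ∀ m : PointMeasure E,
      Tendsto (fun n => ∫ x, s n x ∂m.toMeasure) atTop (𝓝 (∫ x, g x ∂m.toMeasure)) := fun m =>
    tendsto_integral_of_dominated_convergence _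
      (fun n => (s n).measurable.aestronglyMeasurable) (hint m.toMeasure)
      (fun n => ae_of_all _ (hbound n)) (ae_of_all _ hlim)
  have hmeas : ∀ n, Measurable fun m : PointMeasure E => ∫ x, s n x ∂m.toMeasure := by
    intro n
    have h : ∀ m : PointMeasure E, _ := fun m =>
      (s n).integral_comp_eq_sum_inter (hs n)
        (m.finite_on_compacts _ hgc.isCompact) (F := fun z => z) rfl
    simp_rw [h, measureReal_def]
    refine Finset.measurable_fun_sum _ fun y _ => Measurable.smul_const ?_ _
    exact (PointMeasure.measurable_apply
      (((s n).measurableSet_fiber _).inter hgc.isCompact.measurableSet)).ennreal_toReal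
  have hL : Tendsto (fun n => ∫ m, Complex.exp ((∫ x, s n x ∂m.toMeasure : ℝ) * Complex.I) ∂Q)
      atTop (𝓝 (∫ m, Complex.exp ((∫ x, g x ∂m.toMeasure : ℝ) * Complex.I) ∂Q)) := by
    refine tendsto_integral_of_dominated_convergence (fun _ => 1)
      (fun n => ?_) (integrable_const _)
      (fun n => ae_of_all _ fun m => by rw [Complex.norm_exp_ofReal_mul_I])
      (ae_of_all _ fun m => ?_)
    · have := hmeas n
      exact Measurable.aestronglyMeasurable (by fun_prop)
    · have : Continuous fun z : ℝ => Complex.exp (z * Complex.I) := by fun_prop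
      exact (this.tendsto _).comp (hm m)
  have hR : Tendsto (fun n => Complex.exp (∫ x, (Complex.exp (s n x * Complex.I) - 1) ∂Λ))
      atTop (𝓝 (Complex.exp (∫ x, (Complex.exp (g x * Complex.I) - 1) ∂Λ))) := by
    refine (Complex.continuous_exp.tendsto _).comp ?_
    refine tendsto_integral_of_dominated_convergence _ (fun n => ?_) (hint Λ)
      (fun n => ae_of_all _ fun x => (norm_exp_ofReal_mul_I_sub_one_le _).trans (hbound n x))
      (ae_of_all _ fun x => ?_)
    · have := (s n).measurable
      exact Measurable.aestronglyMeasurable (by fun_prop)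
    · have : Continuous fun z : ℝ => Complex.exp (z * Complex.I) - 1 := by fun_prop
      exact (this.tendsto _).comp (hlim x)
  refine tendsto_nhds_unique hL (hR.congr fun n => ?_)
  exact (hQ.integral_exp_simpleFunc (s n) hgc.isCompact hgc.isCompact.measure_lt_top (hs n)).symm

end IsPoissonProcess

/-! ### The Poisson limit theorem for triangular arrays -/

section TriangularArray

variable {E : Type*} [TopologicalSpace E] [MeasurableSpace E]
  [T2Space E] [LocallyCompactSpace E] [SecondCountableTopology E] [BorelSpace E]
  {Ω : ℕ → Type*} [∀ n, MeasurableSpace (Ω n)]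
  {P : ∀ n, Measure (Ω n)} [∀ n, IsProbabilityMeasure (P n)]

omit [LocallyCompactSpace E] [∀ n, IsProbabilityMeasure (P n)] in
-- Independence factorizes the expectation. Splitting off `1` leaves an integrand with compact
-- support whenever `g` has one, and a power of the form `(1 + z)^n`.
theorem integral_exp_ofPoints {n : ℕ} {Y : Fin n → Ω n → E} (hind : iIndepFun Y (P n))
    {μ : Measure E} (hμ : ∀ i, HasLaw (Y i) μ (P n)) [IsProbabilityMeasure μ] {g : E → ℝ}
    (hg : Continuous g) :
    ∫ ω, Complex.exp ((∫ x, g x ∂(PointMeasure.ofPoints fun i => Y i ω).toMeasure : ℝ) * Complex.I)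
      ∂(P n) = (1 + ∫ x, (Complex.exp (g x * Complex.I) - 1) ∂μ) ^ n := by
  have hF : Measurable fun x => Complex.exp (g x * Complex.I) := by fun_prop
  have h1 : ∀ ω, Complex.exp
      ((∫ x, g x ∂(PointMeasure.ofPoints fun i => Y i ω).toMeasure : ℝ) * Complex.I) =
      ∏ i, Complex.exp (g (Y i ω) * Complex.I) := by
    intro ω
    rw [PointMeasure.ofPoints, integral_finsetSum_measure fun i _ => integrable_dirac (by simp),
      ← Complex.exp_sum]
    simp [Finset.sum_mul]
  simp_rw [h1]
  rw [hind.integral_fun_prod_comp (f := fun _ x => Complex.exp (g x * Complex.I))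
    (fun i => (hμ i).aemeasurable) (fun i => hF.aestronglyMeasurable)]
  have h2 : ∀ i, ∫ ω, Complex.exp (g (Y i ω) * Complex.I) ∂(P n) =
      1 + ∫ x, (Complex.exp (g x * Complex.I) - 1) ∂μ := by
    intro i
    have := (hμ i).integral_comp (f := fun x => Complex.exp (g x * Complex.I))
      hF.aestronglyMeasurable
    rw [Function.comp_def] at this
    rw [this, integral_sub _ (integrable_const _)]
    · simp
    · exact Integrable.of_bound hF.aestronglyMeasurable 1
        (ae_of_all _ fun x => by rw [Complex.norm_exp_ofReal_mul_I])
  simp [h2]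

/-- The Poisson limit theorem for the point processes of triangular arrays of independent
identically distributed points. -/
theorem tendstoInDistribution_ofPoints {Λ : Measure E} [IsFiniteMeasureOnCompacts Λ]
    {Y : ∀ n, Fin n → Ω n → E} (hY : ∀ n i, AEMeasurable (Y n i) (P n)) {μ : ℕ → Measure E}
    (hind : ∀ᶠ n in atTop, iIndepFun (Y n) (P n))
    (hlaw : ∀ᶠ n in atTop, ∀ i, HasLaw (Y n i) (μ n) (P n))
    (hμ : ∀ h : E → ℂ, Continuous h → HasCompactSupport h →
      Tendsto (fun n : ℕ => (n : ℂ) * ∫ x, h x ∂μ n) atTop (𝓝 (∫ x, h x ∂Λ)))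
    {Q : ProbabilityMeasure (PointMeasure E)} (hQ : IsPoissonProcess id Λ (Q : Measure _)) :
    TendstoInDistribution (fun n ω => PointMeasure.ofPoints fun i => Y n i ω) atTop id P
      (Q : Measure _) where
  forall_aemeasurable n := PointMeasure.measurable_ofPoints.comp_aemeasurable
    (aemeasurable_pi_lambda _ (hY n))
  tendsto := by
    refine PointMeasure.tendsto_of_tendsto_integral_exp fun g hg hgc => ?_
    simp only [ProbabilityMeasure.coe_mk, Measure.map_id]
    rw [hQ.integral_exp hg hgc]
    have hsupp : HasCompactSupport fun x => Complex.exp (g x * Complex.I) - 1 :=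
      hgc.comp_left (g := fun z : ℝ => Complex.exp (z * Complex.I) - 1) (by simp)
    refine (Complex.tendsto_one_add_pow_exp_of_tendsto (hμ _ (by fun_prop) hsupp)).congr' ?_
    filter_upwards [hind, hlaw, eventually_gt_atTop 0] with n hn hn' hpos
    -- An index in `Fin n` is needed to see that `μ n` is a law, hence `0 < n`.
    have : IsProbabilityMeasure (μ n) := (hn' ⟨0, hpos⟩).isProbabilityMeasure_iff.1 inferInstance
    have hmeas : AEMeasurable (fun ω => PointMeasure.ofPoints fun i => Y n i ω) (P n) :=
      PointMeasure.measurable_ofPoints.comp_aemeasurable (aemeasurable_pi_lambda _ (hY n))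
    have hexp : Continuous fun z : ℝ => Complex.exp (z * Complex.I) := by fun_prop
    exact ((integral_map hmeas (hexp.comp (PointMeasure.continuous_integral_of_hasCompactSupport
      hg hgc)).measurable.aestronglyMeasurable).trans (integral_exp_ofPoints hn hn' hg)).symm

end TriangularArray

/-! ### A Poisson number of independent points in one cell -/

theorem MeasureTheory.Measure.exists_isProbabilityMeasure_smul_eq {E : Type*} [MeasurableSpace E]
    [Nonempty E] (μ : Measure E) [IsFiniteMeasure μ] :
    ∃ p : Measure E, IsProbabilityMeasure p ∧ μ = μ Set.univ • p := by
  by_cases h : μ Set.univ = 0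
  · exact ⟨Measure.dirac (Classical.arbitrary E), inferInstance, by
      rw [h, zero_smul, Measure.measure_univ_eq_zero.1 h]⟩
  · refine ⟨(μ Set.univ)⁻¹ • μ, ⟨?_⟩, ?_⟩
    · simp [ENNReal.inv_mul_cancel h (measure_ne_top _ _)]
    · rw [smul_smul, ENNReal.mul_inv_cancel h (measure_ne_top _ _), one_smul]

/-- The restriction to a set `S` of the point measure of the first `N` terms of a sequence. -/
noncomputable def cellMeasure {E : Type*} [MeasurableSpace E] (S : Set E) (a : ℕ × (ℕ → E)) :
    Measure E :=
  ∑ i ∈ Finset.range a.1, (Measure.dirac (a.2 i)).restrict S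

section CellMeasure

variable {E : Type*} [MeasurableSpace E] {S : Set E}

instance (S : Set E) (a : ℕ × (ℕ → E)) : IsFiniteMeasure (cellMeasure S a) := by
  unfold cellMeasure; infer_instance

theorem cellMeasure_apply {B : Set E} (hB : MeasurableSet B) (hS : MeasurableSet S)
    (a : ℕ × (ℕ → E)) :
    cellMeasure S a B = ∑ i ∈ Finset.range a.1, (S ∩ B).indicator 1 (a.2 i) := by
  simp only [cellMeasure, Measure.finsetSum_apply]
  refine Finset.sum_congr rfl fun i _ => ?_
  rw [Measure.restrict_apply hB, Measure.dirac_apply' _ (hB.inter hS), Set.inter_comm]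

theorem integral_cellMeasure {g : E → ℝ} (hg : Measurable g) (hS : MeasurableSet S)
    (a : ℕ × (ℕ → E)) :
    ∫ x, g x ∂(cellMeasure S a) = ∑ i ∈ Finset.range a.1, S.indicator g (a.2 i) := by
  have h : ∀ i, Integrable g (Measure.dirac (a.2 i)) := fun i =>
    integrable_dirac' hg.stronglyMeasurable (by simp)
  rw [cellMeasure, integral_finsetSum_measure fun i _ => (h i).restrict]
  refine Finset.sum_congr rfl fun i _ => ?_
  rw [← integral_indicator hS, integral_dirac' _ _ (hg.indicator hS).stronglyMeasurable]

theorem measurable_integral_cellMeasure {g : E → ℝ} (hg : Measurable g) (hS : MeasurableSet S) :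
    Measurable fun a : ℕ × (ℕ → E) => ∫ x, g x ∂(cellMeasure S a) := by
  simp_rw [integral_cellMeasure hg hS]
  refine measurable_from_prod_countable_right fun N => ?_
  exact Finset.measurable_fun_sum (Finset.range N)
    fun i _ => (hg.indicator hS).comp (measurable_pi_apply i)

/-- The law of a Poisson number of independent points. -/
theorem integral_exp_cellMeasure {Λ : Measure E} (hS : MeasurableSet S)
    {p : Measure E} [IsProbabilityMeasure p] (hp : Λ.restrict S = Λ S • p) {g : E → ℝ}
    (hg : Measurable g) :
    ∫ a, Complex.exp ((∫ x, g x ∂(cellMeasure S a) : ℝ) * Complex.I)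
        ∂((poissonMeasure (Λ S).toNNReal).prod (Measure.infinitePi fun _ : ℕ => p)) =
      Complex.exp (∫ x in S, (Complex.exp (g x * Complex.I) - 1) ∂Λ) := by
  have hF : Measurable fun x => Complex.exp (S.indicator g x * Complex.I) := by
    have := hg.indicator hS
    fun_prop
  set φ : ℂ := ∫ x, Complex.exp (S.indicator g x * Complex.I) ∂p with hφ
  have hm := measurable_integral_cellMeasure hg hS
  have hint : Integrable (fun a : ℕ × (ℕ → E) =>
      Complex.exp ((∫ x, g x ∂(cellMeasure S a) : ℝ) * Complex.I))
      ((poissonMeasure (Λ S).toNNReal).prod (Measure.infinitePi fun _ : ℕ => p)) :=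
    Integrable.of_bound (Measurable.aestronglyMeasurable (by fun_prop)) 1
      (ae_of_all _ fun x => by rw [Complex.norm_exp_ofReal_mul_I])
  have hinner : ∀ N : ℕ, ∫ x : ℕ → E, Complex.exp
      ((∫ y, g y ∂(cellMeasure S (N, x)) : ℝ) * Complex.I) ∂(Measure.infinitePi fun _ : ℕ => p) =
      φ ^ N := by
    intro N
    have hind := (iIndepFun_infinitePi (P := fun _ : ℕ => p) (X := fun _ (x : E) => x)
      fun _ => measurable_id).precomp (g := fun i : Fin N => (i : ℕ)) Fin.val_injective
    have h := hind.integral_fun_prod_comp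
      (f := fun _ x => Complex.exp (S.indicator g x * Complex.I))
      (fun i => (measurable_pi_apply _).aemeasurable) (fun i => hF.aestronglyMeasurable)
    have h1 : ∀ x : ℕ → E, Complex.exp ((∫ y, g y ∂(cellMeasure S (N, x)) : ℝ) * Complex.I) =
        ∏ i : Fin N, Complex.exp (S.indicator g (x i) * Complex.I) := by
      intro x
      rw [integral_cellMeasure hg hS, Finset.sum_range, ← Complex.exp_sum, Complex.ofReal_sum,
        Finset.sum_mul]
    simp_rw [h1]
    rw [h]
    have h2 : ∀ i : ℕ, ∫ x : ℕ → E, Complex.exp (S.indicator g (x i) * Complex.I)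
        ∂(Measure.infinitePi fun _ : ℕ => p) = φ := by
      intro i
      have := integral_map (μ := Measure.infinitePi fun _ : ℕ => p)
        (measurable_pi_apply i).aemeasurable hF.aestronglyMeasurable
      rw [← this]
      exact congrArg (fun μ : Measure E => ∫ x, Complex.exp (S.indicator g x * Complex.I) ∂μ)
        (measurePreserving_eval_infinitePi (fun _ : ℕ => p) i).map_eq
    simp [h2]
  rw [integral_prod _ hint]
  simp_rw [hinner]
  -- The generating function of the Poisson law, evaluated at `φ`.
  have hsum : ∑' n : ℕ, (Real.exp (-((Λ S).toNNReal : ℝ)) * ((Λ S).toNNReal : ℝ) ^ n /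
      (n.factorial : ℝ)) • φ ^ n = Complex.exp ((Λ S).toReal * (φ - 1)) := by
    have hs := (NormedSpace.expSeries_div_hasSum_exp (((Λ S).toReal : ℂ) * φ)).mul_left
      (Complex.exp (-(Λ S).toReal))
    rw [← Complex.exp_eq_exp_ℂ, ← Complex.exp_add] at hs
    rw [show ((Λ S).toReal : ℂ) * (φ - 1) = -(Λ S).toReal + (Λ S).toReal * φ by ring, ← hs.tsum_eq]
    congr 1 with n
    rw [ENNReal.coe_toNNReal_eq_toReal, Complex.real_smul, mul_pow]
    push_cast
    ring
  rw [integral_poissonMeasure, hsum]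
  congr 1
  have hS1 : ∫ x in S, (Complex.exp (g x * Complex.I) - 1) ∂Λ =
      ∫ x in S, (Complex.exp (S.indicator g x * Complex.I) - 1) ∂Λ :=
    setIntegral_congr_fun hS fun x hx => by simp [hx]
  rw [hS1, hp, integral_smul_measure, integral_sub _ (integrable_const _)]
  · simp [φ]
  · exact Integrable.of_bound hF.aestronglyMeasurable 1
        (ae_of_all _ fun x => by rw [Complex.norm_exp_ofReal_mul_I])

end CellMeasure

theorem exists_pointMeasure_sum_cellMeasure {E : Type*} [MeasurableSpace E] {S : ℕ → Set E}
    (hS : ∀ k, MeasurableSet (S k)) (ω : ℕ → ℕ × (ℕ → E)) :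
    ∃ (ι : Type) (_ : Countable ι) (x : ι → E),
      Measure.sum (fun k => cellMeasure (S k) (ω k)) = Measure.sum fun i => Measure.dirac (x i) := by
  -- The atoms are indexed by pairs (cell, rank) whose rank is below the count of the cell and whose
  -- point lies in that cell.
  let A : Set (ℕ × ℕ) := {q | q.2 < (ω q.1).1 ∧ (ω q.1).2 q.2 ∈ S q.1}
  refine ⟨A, inferInstance, fun q => (ω q.1.1).2 q.1.2, Measure.ext fun B hB => ?_⟩
  rw [Measure.sum_apply _ hB, Measure.sum_apply _ hB]
  simp_rw [Measure.dirac_apply' _ hB]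
  rw [tsum_subtype A fun q => B.indicator (1 : E → ℝ≥0∞) ((ω q.1).2 q.2), ENNReal.tsum_prod']
  refine tsum_congr fun k => ?_
  rw [cellMeasure_apply hB (hS k), tsum_eq_sum (s := Finset.range (ω k).1)]
  · refine Finset.sum_congr rfl fun i hi => ?_
    have hi' := Finset.mem_range.1 hi
    by_cases h1 : (ω k).2 i ∈ S k <;> by_cases h2 : (ω k).2 i ∈ B <;>
      simp [A, Set.indicator, hi', h1, h2]
  · intro i hi
    simp [A, Set.indicator] at hi ⊢
    omega

/-! ### Superposition over a compact exhaustion -/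

section Construction

variable {E : Type*} [TopologicalSpace E] [MeasurableSpace E]
  [T2Space E] [BorelSpace E]

theorem measurableSet_disjointed_compactExhaustion (K : CompactExhaustion E) (k : ℕ) :
    MeasurableSet (disjointed (fun n => K n) k) :=
  MeasurableSet.disjointed (fun n => (K.isCompact n).measurableSet) k

/-- Later cells avoid `K n`. Restricting the Dirac masses to the cell makes this hold for every
sample, not just almost surely, so `superposition` is always locally finite. -/
theorem cellMeasure_disjointed_eq_zero (K : CompactExhaustion E) {n k : ℕ} (hk : n < k)
    (a : ℕ × (ℕ → E)) : cellMeasure (disjointed (fun n => K n) k) a (K n) = 0 := by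
  rw [cellMeasure_apply (K.isCompact n).measurableSet
    (measurableSet_disjointed_compactExhaustion K k)]
  have : disjointed (fun n => K n) k ∩ K n = ∅ := by
    rw [← Set.disjoint_iff_inter_eq_empty]
    have := disjointed_apply (fun n => (K n : Set E)) k
    rw [this, Set.disjoint_left]
    intro x hx hx'
    exact hx.2 (Finset.le_sup (f := fun n => (K n : Set E)) (Finset.mem_Iio.2 hk) hx')
  simp [this]

/-- The superposition of the point measures in the cells of a compact exhaustion. -/
noncomputable def superposition (K : CompactExhaustion E) (ω : ℕ → ℕ × (ℕ → E)) :
    PointMeasure E where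
  toMeasure := Measure.sum fun k => cellMeasure (disjointed (fun n => K n) k) (ω k)
  finite_on_compacts C hC := by
    obtain ⟨n, hn⟩ := K.exists_superset_of_isCompact hC
    refine (measure_mono hn).trans_lt ?_
    rw [Measure.sum_apply _ (K.isCompact n).measurableSet,
      tsum_eq_sum (s := Finset.range (n + 1)) fun k hk => ?_]
    · exact ENNReal.sum_lt_top.2 fun k _ => measure_lt_top _ _
    · exact cellMeasure_disjointed_eq_zero K (by simpa using hk) _
  isPoint := exists_pointMeasure_sum_cellMeasure (measurableSet_disjointed_compactExhaustion K) ω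

theorem integral_superposition (K : CompactExhaustion E) (ω : ℕ → ℕ × (ℕ → E)) {g : E → ℝ}
    (hg : Measurable g) {C : ℝ} (hC : ∀ x, |g x| ≤ C) {n : ℕ} (hn : ∀ x ∉ K n, g x = 0) :
    ∫ x, g x ∂(superposition K ω).toMeasure =
      ∑ k ∈ Finset.range (n + 1), ∫ x, g x ∂(cellMeasure (disjointed (fun n => K n) k) (ω k)) := by
  have hint : Integrable g (superposition K ω).toMeasure := by
    rw [← integrableOn_iff_integrable_of_support_subset (s := K n)
      (fun x hx => by_contra fun h => hx (hn x h))]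
    exact IntegrableOn.of_bound ((superposition K ω).finite_on_compacts _ (K.isCompact n))
      hg.aestronglyMeasurable C (ae_of_all _ hC)
  refine (hasSum_integral_measure hint).unique (hasSum_sum_of_ne_finset_zero fun k hk => ?_)
  rw [← setIntegral_eq_integral_of_forall_compl_eq_zero (s := K n) hn]
  exact setIntegral_measure_zero _ (cellMeasure_disjointed_eq_zero K (by simpa using hk) _)

variable [LocallyCompactSpace E] [SecondCountableTopology E]

theorem measurable_superposition (K : CompactExhaustion E) : Measurable (superposition K) := by
  refine PointMeasure.measurable_of_measurable_integral fun f => ?_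
  obtain ⟨n, hn⟩ := K.exists_superset_of_isCompact f.hasCompactSupport
  have hfm : Measurable fun x => (f x : ℝ) := (NNReal.continuous_coe.comp f.continuous).measurable
  obtain ⟨C, hC⟩ := (f.hasCompactSupport.comp_left (g := NNReal.toReal)
    rfl).exists_bound_of_continuous (NNReal.continuous_coe.comp f.continuous)
  simp_rw [fun ω => integral_superposition K ω hfm hC (n := n)
    (fun x hx => by simp [image_eq_zero_of_notMem_tsupport fun h => hx (hn h)])]
  refine Finset.measurable_fun_sum _ fun k _ => ?_
  exact (measurable_integral_cellMeasure hfm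
    (measurableSet_disjointed_compactExhaustion K k)).comp (measurable_pi_apply k)

omit [LocallyCompactSpace E] [SecondCountableTopology E] in
-- Cells `0, …, n` partition `K n` and their contents are independent: the one-cell functionals
-- multiply and the integrals in the exponents add up.
theorem integral_exp_superposition (K : CompactExhaustion E) {Λ : Measure E}
    [IsFiniteMeasureOnCompacts Λ] {p : ℕ → Measure E} [∀ k, IsProbabilityMeasure (p k)]
    (hp : ∀ k, Λ.restrict (disjointed (fun n => K n) k) =
      Λ (disjointed (fun n => K n) k) • p k) {g : E → ℝ}
    (hg : Measurable g) {C : ℝ} (hC : ∀ x, |g x| ≤ C) {n : ℕ} (hn : ∀ x ∉ K n, g x = 0) :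
    ∫ ω, Complex.exp ((∫ x, g x ∂(superposition K ω).toMeasure : ℝ) * Complex.I)
      ∂(Measure.infinitePi fun k =>
        (poissonMeasure (Λ (disjointed (fun n => K n) k)).toNNReal).prod
          (Measure.infinitePi fun _ : ℕ => p k)) =
      Complex.exp (∫ x, (Complex.exp (g x * Complex.I) - 1) ∂Λ) := by
  set S : ℕ → Set E := disjointed fun n => K n with hSdef
  have hS : ∀ k, MeasurableSet (S k) := measurableSet_disjointed_compactExhaustion K
  have hSΛ : ∀ k, Λ (S k) < ∞ := fun k =>
    (measure_mono (disjointed_subset _ k)).trans_lt (K.isCompact k).measure_lt_top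
  let ν : ℕ → Measure (ℕ × (ℕ → E)) := fun k =>
    (poissonMeasure (Λ (S k)).toNNReal).prod (Measure.infinitePi fun _ : ℕ => p k)
  have hm : ∀ k, Measurable fun a : ℕ × (ℕ → E) =>
      Complex.exp ((∫ x, g x ∂(cellMeasure (S k) a) : ℝ) * Complex.I) := fun k => by
    have := measurable_integral_cellMeasure hg (hS k)
    fun_prop
  have hind := (iIndepFun_infinitePi (P := ν) (X := fun _ a => a)
      fun _ => measurable_id).precomp (g := fun i : Fin (n + 1) => (i : ℕ)) Fin.val_injective
  have h := hind.integral_fun_prod_comp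
    (f := fun (k : Fin (n + 1)) (a : ℕ × (ℕ → E)) =>
      Complex.exp ((∫ x, g x ∂(cellMeasure (S k) a) : ℝ) * Complex.I))
    (fun i => (measurable_pi_apply _).aemeasurable) (fun i => (hm i).aestronglyMeasurable)
  have h1 : ∀ ω, Complex.exp ((∫ x, g x ∂(superposition K ω).toMeasure : ℝ) * Complex.I) =
      ∏ k : Fin (n + 1),
        Complex.exp ((∫ x, g x ∂(cellMeasure (S k) (ω k)) : ℝ) * Complex.I) := by
    intro ω
    rw [integral_superposition K ω hg hC hn, Finset.sum_range, ← Complex.exp_sum,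
      Complex.ofReal_sum, Finset.sum_mul]
  simp_rw [h1]
  rw [h]
  have h2 : ∀ k : ℕ, ∫ ω, Complex.exp ((∫ x, g x ∂(cellMeasure (S k) (ω k)) : ℝ) * Complex.I)
      ∂(Measure.infinitePi ν) =
      Complex.exp (∫ x in S k, (Complex.exp (g x * Complex.I) - 1) ∂Λ) := by
    intro k
    rw [← integral_exp_cellMeasure (hS k) (hp k) hg]
    have := integral_map (μ := Measure.infinitePi ν) (measurable_pi_apply k).aemeasurable
      (hm k).aestronglyMeasurable
    rw [← this]
    exact congrArg (fun μ : Measure (ℕ × (ℕ → E)) =>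
      ∫ a, Complex.exp ((∫ x, g x ∂(cellMeasure (S k) a) : ℝ) * Complex.I) ∂μ)
      (measurePreserving_eval_infinitePi ν k).map_eq
  simp_rw [h2]
  rw [← Complex.exp_sum]
  congr 1
  have hmono : partialSups (fun n => (K n : Set E)) n = K n :=
    congrFun (Monotone.partialSups_eq fun i j hij => K.subset hij) n
  have hF : Measurable fun x => Complex.exp (g x * Complex.I) - 1 := by fun_prop
  rw [← setIntegral_eq_integral_of_forall_compl_eq_zero (s := K n)
    (fun x hx => by simp [hn x hx]), ← hmono, ← biUnion_range_succ_disjointed,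
    integral_biUnion_finset _ (fun k _ => hS k)
      (fun i _ j _ hij => disjoint_disjointed _ hij), Finset.sum_range]
  intro k _
  exact IntegrableOn.of_bound (hSΛ k) hF.aestronglyMeasurable C
    (ae_of_all _ fun x => (norm_exp_ofReal_mul_I_sub_one_le _).trans (hC x))

end Construction

/-! ### Monotone limits of counts -/

section ENNRealLimits

variable {Ω : Type*} [MeasurableSpace Ω] {P : Measure Ω} [IsProbabilityMeasure P]

/-- For increasing variables these events decrease to their intersection. Since the sets `Iic a`
form a generating π-system, such limits determine laws and independence. -/
theorem tendsto_measure_forall_iSup_le {ι : Type*} [Finite ι] {X : ℕ → ι → Ω → ℝ≥0∞}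
    (hX : ∀ n i, Measurable (X n i)) (hmono : ∀ i ω, Monotone fun n => X n i ω) (a : ι → ℝ≥0∞) :
    Tendsto (fun n => P {ω | ∀ i, X n i ω ≤ a i}) atTop (𝓝 (P {ω | ∀ i, ⨆ n, X n i ω ≤ a i})) := by
  have h : {ω | ∀ i, ⨆ n, X n i ω ≤ a i} = ⋂ n, {ω | ∀ i, X n i ω ≤ a i} := by
    ext ω
    simp only [Set.mem_ofPred_eq, Set.mem_iInter, iSup_le_iff]
    exact forall_comm
  rw [h]
  refine tendsto_measure_iInter_atTop (fun n => ?_) (fun m n hmn ω hω i => ?_)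
    ⟨0, measure_ne_top _ _⟩
  · rw [Set.ofPred_forall]
    exact (MeasurableSet.iInter fun i => measurableSet_le (hX n i) measurable_const).nullMeasurableSet
  · exact (hmono i ω hmn).trans (hω i)

/-- Independence is preserved under monotone limits. -/
theorem iIndepFun_iSup {ι : Type*} [Fintype ι] {X : ℕ → ι → Ω → ℝ≥0∞}
    (hX : ∀ n i, Measurable (X n i)) (hmono : ∀ i ω, Monotone fun n => X n i ω)
    (hind : ∀ n, iIndepFun (X n) P) : iIndepFun (fun i ω => ⨆ n, X n i ω) P := by
  have hm : ∀ i, Measurable fun ω => ⨆ n, X n i ω := fun i => Measurable.iSup fun n => hX n i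
  rw [iIndepFun_iff_map_fun_eq_pi_map fun i => (hm i).aemeasurable]
  have hprob : ∀ i, IsProbabilityMeasure (P.map fun ω => ⨆ n, X n i ω) := fun i =>
    Measure.isProbabilityMeasure_map (hm i).aemeasurable
  symm
  refine Measure.pi_eq_generateFrom (C := fun _ => Set.range Set.Iic)
    (fun _ => ((BorelSpace.measurable_eq (α := ℝ≥0∞)).trans (borel_eq_generateFrom_Iic _)).symm)
    (fun _ => isPiSystem_Iic) (fun i => ⟨fun _ => Set.univ, fun _ => ⟨⊤, Set.Iic_top⟩,
      fun _ => measure_lt_top _ _, Set.iUnion_const _⟩) fun s hs => ?_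
  choose a ha using hs
  obtain rfl : (fun i => Set.Iic (a i)) = s := funext ha
  rw [Measure.map_apply (measurable_pi_lambda _ hm)
    (MeasurableSet.univ_pi fun i => measurableSet_Iic)]
  simp_rw [fun i => Measure.map_apply (μ := P) (hm i) (measurableSet_Iic (a := a i))]
  have h1 := tendsto_measure_forall_iSup_le (P := P) hX hmono a
  have h2 : ∀ i, Tendsto (fun n => P (X n i ⁻¹' Set.Iic (a i))) atTop
      (𝓝 (P ((fun ω => ⨆ n, X n i ω) ⁻¹' Set.Iic (a i)))) := fun i => by
    have := tendsto_measure_forall_iSup_le (P := P) (ι := Unit) (X := fun n _ => X n i)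
      (fun n _ => hX n i) (fun _ => hmono i) (fun _ => a i)
    simpa [Set.preimage, Set.mem_Iic] using this
  have h3 := ENNReal.tendsto_finsetProd_of_ne_top Finset.univ (fun i _ => h2 i)
    (fun i _ => measure_ne_top _ _)
  have h4 : ∀ n, P {ω | ∀ i, X n i ω ≤ a i} = ∏ i, P (X n i ⁻¹' Set.Iic (a i)) := fun n => by
    rw [← (hind n).measure_inter_preimage_eq_mul Finset.univ
      (sets := fun i => Set.Iic (a i)) fun i _ => measurableSet_Iic]
    congr 1
    ext ω
    simp
  simp_rw [h4] at h1
  convert tendsto_nhds_unique h1 h3 using 2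
  ext ω
  simp [Pi.le_def]

theorem tendsto_poissonMeasure_apply {r : ℕ → ℝ≥0} {r₀ : ℝ≥0} (hr : Tendsto r atTop (𝓝 r₀))
    {s : Set ℕ} (hs : s.Finite) :
    Tendsto (fun n => poissonMeasure (r n) s) atTop (𝓝 (poissonMeasure r₀ s)) := by
  have h : ∀ q : ℝ≥0, poissonMeasure q s = ∑ k ∈ hs.toFinset, poissonMeasure q {k} := fun q => by
    rw [sum_measure_singleton, hs.coe_toFinset]
  simp_rw [h, poissonMeasure_singleton]
  refine tendsto_finsetSum _ fun k _ => (ENNReal.continuous_ofReal.tendsto _).comp ?_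
  have : Continuous fun q : ℝ≥0 =>
      Real.exp (-(q : ℝ)) * (q : ℝ) ^ k / (k.factorial : ℝ) := by fun_prop
  exact (this.tendsto r₀).comp hr

/-- A monotone limit of Poisson variables with convergent parameters is a Poisson variable. -/
theorem map_iSup_eq_poissonMeasure {X : ℕ → Ω → ℝ≥0∞} (hX : ∀ n, Measurable (X n))
    (hmono : ∀ ω, Monotone fun n => X n ω) {r : ℕ → ℝ≥0} {r₀ : ℝ≥0}
    (hr : Tendsto r atTop (𝓝 r₀))
    (hlaw : ∀ n, P.map (X n) = (poissonMeasure (r n)).map fun k : ℕ => (k : ℝ≥0∞)) :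
    P.map (fun ω => ⨆ n, X n ω) = (poissonMeasure r₀).map fun k : ℕ => (k : ℝ≥0∞) := by
  have hm : Measurable fun ω => ⨆ n, X n ω := Measurable.iSup hX
  have : IsProbabilityMeasure (P.map fun ω => ⨆ n, X n ω) :=
    Measure.isProbabilityMeasure_map hm.aemeasurable
  have : IsProbabilityMeasure ((poissonMeasure r₀).map fun k : ℕ => (k : ℝ≥0∞)) :=
    Measure.isProbabilityMeasure_map (by fun_prop)
  refine Measure.ext_of_Iic _ _ fun a => ?_
  -- For `a = ⊤` the preimage in `ℕ` is infinite, but both masses are `1`.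
  by_cases ha : a = ⊤
  · simp [ha]
  have hfin : ((fun k : ℕ => (k : ℝ≥0∞)) ⁻¹' Set.Iic a).Finite := by
    refine (Set.finite_Iic ⌊a.toReal⌋₊).subset fun k hk => ?_
    have : (k : ℝ≥0∞) ≤ a := hk
    refine Nat.le_floor ?_
    simpa using ENNReal.toReal_mono ha this
  have h1 := tendsto_measure_forall_iSup_le (P := P) (ι := Unit) (X := fun n _ => X n)
      (fun n _ => hX n) (fun _ => hmono) (fun _ => a)
  have h2 := tendsto_poissonMeasure_apply hr hfin
  rw [Measure.map_apply hm measurableSet_Iic, Measure.map_apply (by fun_prop) measurableSet_Iic]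
  refine tendsto_nhds_unique ?_ h2
  have h3 : ∀ n, poissonMeasure (r n) ((fun k : ℕ => (k : ℝ≥0∞)) ⁻¹' Set.Iic a) =
      P {ω | X n ω ≤ a} := fun n => by
    rw [← Measure.map_apply (by fun_prop) measurableSet_Iic, ← hlaw,
      Measure.map_apply (hX n) measurableSet_Iic]
    rfl
  simp_rw [h3]
  simpa [Set.preimage, Set.mem_Iic] using h1

end ENNRealLimits

/-- At each point at most one indicator is nonzero, so `F` passes through the sum. -/
theorem integral_comp_sum_indicator {E : Type*} [MeasurableSpace E]
    {G : Type*} [NormedAddCommGroup G] [NormedSpace ℝ G]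
    [CompleteSpace G] {k : ℕ} {B : Fin k → Set E} (hB : ∀ i, MeasurableSet (B i))
    (hdisj : Pairwise fun i j => Disjoint (B i) (B j)) (t : Fin k → ℝ) {F : ℝ → G} (hF : F 0 = 0)
    {μ : Measure E} (hμ : ∀ i, μ (B i) < ∞) :
    ∫ x, F (∑ i, (B i).indicator (fun _ => t i) x) ∂μ = ∑ i, μ.real (B i) • F (t i) := by
  have h : ∀ x, F (∑ i, (B i).indicator (fun _ => t i) x) =
      ∑ i, (B i).indicator (fun _ => F (t i)) x := by
    intro x
    by_cases hx : ∃ i, x ∈ B i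
    · obtain ⟨i, hi⟩ := hx
      have hj : ∀ j, j ≠ i → x ∉ B j := fun j hj h => Set.disjoint_left.1 (hdisj hj) h hi
      rw [Finset.sum_eq_single i (fun j _ hji => by simp [hj j hji]) (by simp),
        Finset.sum_eq_single i (fun j _ hji => by simp [hj j hji]) (by simp)]
      simp [hi]
    · push Not at hx
      simp [hx, hF]
  simp_rw [h]
  rw [integral_finsetSum _ fun i _ =>
    (integrable_indicator_iff (hB i)).2 (integrableOn_const (hμ i).ne)]
  simp_rw [integral_indicator_const _ (hB _)]

/-! ### Characterization and existence of Poisson processes -/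

section Characterization

variable {E : Type*} [TopologicalSpace E] [MeasurableSpace E]
  [T2Space E] [LocallyCompactSpace E] [SecondCountableTopology E] [BorelSpace E]
  {Ω : Type*} [MeasurableSpace Ω] {P : Measure Ω} [IsProbabilityMeasure P]
  {η : Ω → PointMeasure E} {Λ : Measure E}

/-- A point process whose characteristic functional is that of the Poisson process, for functions
vanishing off a compact set, is a Poisson process. -/
theorem isPoissonProcess_of_integral_exp [IsFiniteMeasureOnCompacts Λ] (K : CompactExhaustion E)
    (hη : Measurable η)
    (h : ∀ (g : E → ℝ) (C : ℝ) (n : ℕ), Measurable g → (∀ x, |g x| ≤ C) → (∀ x ∉ K n, g x = 0) →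
      ∫ ω, Complex.exp ((∫ x, g x ∂(η ω).toMeasure : ℝ) * Complex.I) ∂P =
        Complex.exp (∫ x, (Complex.exp (g x * Complex.I) - 1) ∂Λ)) :
    IsPoissonProcess η Λ P := by
  have hKm : ∀ n, MeasurableSet (K n) := fun n => (K.isCompact n).measurableSet
  have hmeas : ∀ {B : Set E}, MeasurableSet B → Measurable fun ω => (η ω).toMeasure B :=
    fun hB => (PointMeasure.measurable_apply hB).comp hη
  have hfin : ∀ (B : Set E) n ω, (η ω).toMeasure (B ∩ K n) < ∞ := fun B n ω =>
    (measure_mono Set.inter_subset_right).trans_lt ((η ω).finite_on_compacts _ (K.isCompact n))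
  have hΛfin : ∀ (B : Set E) n, Λ (B ∩ K n) < ∞ := fun B n =>
    (measure_mono Set.inter_subset_right).trans_lt (K.isCompact n).measure_lt_top
  have hmono : ∀ (B : Set E) (μ : Measure E), Monotone fun n => μ (B ∩ K n) :=
    fun B μ i j hij => measure_mono (Set.inter_subset_inter_right B (K.subset hij))
  -- Testing with `∑ t i * 1_{B i ∩ K n}`, which is not continuous, gives the joint characteristic
  -- function of the counts in product form.
  have hjoint : ∀ (k : ℕ) (B : Fin k → Set E) (n : ℕ) (t : Fin k → ℝ),
      (∀ i, MeasurableSet (B i)) → Pairwise (fun i j => Disjoint (B i) (B j)) →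
      ∫ ω, Complex.exp ((∑ i, (η ω).toMeasure.real (B i ∩ K n) * t i : ℝ) * Complex.I) ∂P =
        ∏ i, Complex.exp (Λ.real (B i ∩ K n) * (Complex.exp (t i * Complex.I) - 1)) := by
    intro k B n t hB hdisj
    have hBK : ∀ i, MeasurableSet (B i ∩ K n) := fun i => (hB i).inter (hKm n)
    have hdisj' : Pairwise fun i j => Disjoint (B i ∩ K n) (B j ∩ K n) := fun i j hij =>
      (hdisj hij).mono Set.inter_subset_left Set.inter_subset_left
    have key := h (fun x => ∑ i, (B i ∩ K n).indicator (fun _ => t i) x) (∑ i, |t i|) n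
      (Finset.measurable_fun_sum _ fun i _ => measurable_const.indicator (hBK i))
      (fun x => (Finset.abs_sum_le_sum_abs _ _).trans (Finset.sum_le_sum fun i _ => by
        by_cases hx : x ∈ B i ∩ K n <;> simp [hx]))
      (fun x hx => Finset.sum_eq_zero fun i _ => Set.indicator_of_notMem (fun h => hx h.2) _)
    simp_rw [fun ω => integral_comp_sum_indicator hBK hdisj' t (F := fun z => z) rfl
      fun i => hfin (B i) n ω] at key
    rw [integral_comp_sum_indicator hBK hdisj' t
      (F := fun z : ℝ => Complex.exp (z * Complex.I) - 1) (by simp) fun i => hΛfin (B i) n,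
      Complex.exp_sum] at key
    simpa using key
  have hreal : ∀ (B : Set E) n, MeasurableSet B →
      Measurable fun ω => (η ω).toMeasure.real (B ∩ K n) := fun B n hB =>
    (hmeas (hB.inter (hKm n))).ennreal_toReal
  have hcf : ∀ (B : Set E) n, MeasurableSet B → ∀ t : ℝ,
      charFun (P.map fun ω => (η ω).toMeasure.real (B ∩ K n)) t =
        Complex.exp (Λ.real (B ∩ K n) * (Complex.exp (t * Complex.I) - 1)) := by
    intro B n hB t
    rw [charFun_apply, integral_map (hreal B n hB).aemeasurable (by fun_prop)]
    have := hjoint 1 (fun _ => B) n (fun _ => t) (fun _ => hB)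
      (fun i j hij => (hij (Subsingleton.elim i j)).elim)
    simpa [mul_comm] using this
  have hofReal : ∀ (B : Set E) n ω, (η ω).toMeasure (B ∩ K n) =
      ENNReal.ofReal ((η ω).toMeasure.real (B ∩ K n)) := fun B n ω => by
    rw [measureReal_def, ENNReal.ofReal_toReal (hfin B n ω).ne]
  -- Inside `K n` all counts are finite and real characteristic functions apply. Letting `n` grow
  -- treats general sets, including, for independence, those with infinite counts.
  refine ⟨hη.aemeasurable, fun B hB hΛ => ⟨(hmeas hB).aemeasurable, ?_⟩, fun k B hB hdisj => ?_⟩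
  · simp_rw [← fun ω => PointMeasure.iSup_measure_inter_compactExhaustion K (η ω).toMeasure B]
    refine map_iSup_eq_poissonMeasure (r := fun n => (Λ (B ∩ K n)).toNNReal)
      (fun n => hmeas (hB.inter (hKm n))) (fun ω => hmono B _) ?_ fun n => ?_
    · refine (ENNReal.tendsto_toNNReal hΛ.ne).comp ?_
      rw [← PointMeasure.iSup_measure_inter_compactExhaustion K Λ B]
      exact tendsto_atTop_iSup (hmono B Λ)
    · have h1 : P.map (fun ω => (η ω).toMeasure.real (B ∩ K n)) =
          (poissonMeasure (Λ (B ∩ K n)).toNNReal).map (fun k : ℕ => (k : ℝ)) := by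
        have : IsProbabilityMeasure (P.map fun ω => (η ω).toMeasure.real (B ∩ K n)) :=
          Measure.isProbabilityMeasure_map (hreal B n hB).aemeasurable
        have : IsProbabilityMeasure
            ((poissonMeasure (Λ (B ∩ K n)).toNNReal).map (fun k : ℕ => (k : ℝ))) :=
          Measure.isProbabilityMeasure_map (by fun_prop)
        refine Measure.ext_of_charFun (funext fun t => ?_)
        rw [hcf B n hB, charFun_map_cast_poissonMeasure]
        rfl
      have h2 := congrArg (Measure.map ENNReal.ofReal) h1
      rw [Measure.map_map ENNReal.measurable_ofReal (hreal B n hB),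
        Measure.map_map ENNReal.measurable_ofReal (by fun_prop)] at h2
      simp only [Function.comp_def, ← hofReal, ENNReal.ofReal_natCast] at h2
      exact h2
  · simp_rw [← fun i ω =>
      PointMeasure.iSup_measure_inter_compactExhaustion K (η ω).toMeasure (B i)]
    refine iIndepFun_iSup (fun n i => hmeas ((hB i).inter (hKm n))) (fun i ω => hmono (B i) _)
      fun n => ?_
    have h1 : iIndepFun (fun i ω => (η ω).toMeasure.real (B i ∩ K n)) P := by
      rw [iIndepFun_iff_charFun_pi fun i => (hreal (B i) n (hB i)).aemeasurable]
      intro t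
      have hm : Measurable fun ω =>
          WithLp.toLp 2 fun i => (η ω).toMeasure.real (B i ∩ K n) := by
        have := fun i => hreal (B i) n (hB i)
        fun_prop
      rw [charFun_apply, integral_map hm.aemeasurable (by fun_prop)]
      simp_rw [fun i => hcf (B i) n (hB i)]
      rw [← hjoint k B n (fun i => t i) hB hdisj]
      simp [PiLp.inner_apply, mul_comm]
    have h2 := h1.comp (fun _ => ENNReal.ofReal) fun _ => ENNReal.measurable_ofReal
    simpa only [Function.comp_def, ← hofReal] using h2

/-- Existence of Poisson processes with locally finite intensity. -/
theorem exists_isPoissonProcess [Nonempty E] (Λ : Measure E) [IsFiniteMeasureOnCompacts Λ] :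
    ∃ Q : ProbabilityMeasure (PointMeasure E), IsPoissonProcess id Λ (Q : Measure _) := by
  let K := CompactExhaustion.choice E
  have hSfin : ∀ k, IsFiniteMeasure (Λ.restrict (disjointed (fun n => K n) k)) := fun k =>
    ⟨by
      rw [Measure.restrict_apply_univ]
      exact (measure_mono (disjointed_subset _ k)).trans_lt (K.isCompact k).measure_lt_top⟩
  choose p hp hpΛ using fun k =>
    (Λ.restrict (disjointed (fun n => K n) k)).exists_isProbabilityMeasure_smul_eq
  simp only [Measure.restrict_apply_univ] at hpΛ
  let P : Measure (ℕ → ℕ × (ℕ → E)) := Measure.infinitePi fun k =>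
    (poissonMeasure (Λ (disjointed (fun n => K n) k)).toNNReal).prod
      (Measure.infinitePi fun _ : ℕ => p k)
  have hη := measurable_superposition K
  have hpois : IsPoissonProcess (superposition K) Λ P :=
    isPoissonProcess_of_integral_exp K hη fun g C n hg hC hn =>
      integral_exp_superposition K hpΛ hg hC hn
  -- Both defining properties concern the law of the counts, which are measurable on `M_p(E)`, so
  -- they transfer to the image law.
  refine ⟨⟨P.map (superposition K), Measure.isProbabilityMeasure_map hη.aemeasurable⟩,
    aemeasurable_id, fun B hB hΛ => ⟨(PointMeasure.measurable_apply hB).aemeasurable, ?_⟩,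
    fun k B hB hdisj => ?_⟩
  · rw [← (hpois.poisson_count B hB hΛ).map_eq]
    exact Measure.map_map (PointMeasure.measurable_apply hB) hη
  · have : IsProbabilityMeasure (P.map (superposition K)) :=
      Measure.isProbabilityMeasure_map hη.aemeasurable
    have hi := hpois.indep_count k B hB hdisj
    have hm := fun i => PointMeasure.measurable_apply (hB i)
    have hi' := (iIndepFun_iff_map_fun_eq_pi_map fun i => ((hm i).comp hη).aemeasurable).1 hi
    simp only [ProbabilityMeasure.coe_mk, id]
    rw [iIndepFun_iff_map_fun_eq_pi_map fun i => (hm i).aemeasurable,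
      Measure.map_map (measurable_pi_lambda _ hm) hη]
    simp_rw [Measure.map_map (hm _) hη]
    exact hi'

end Characterization

/-! ### The radial law of a node -/

namespace RandomHyperbolicGraph

/-- The modulus is `tanh (r/2)`, and `tanh / √(1 - tanh²) = sinh` at `r/2`, which `arsinh` inverts.
-/
theorem radius_ofPolar {r : ℝ} (hr : 0 ≤ r) (θ : ℝ) : radius (ofPolar (r, θ)) = r := by
  have hw : ‖((ofPolar (r, θ) : Complex.UnitDisc) : ℂ)‖ = Real.tanh (r / 2) := by
    change ‖(Real.tanh (r / 2) * Complex.exp (θ * Complex.I) : ℂ)‖ = _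
    rw [norm_mul, Complex.norm_exp_ofReal_mul_I, mul_one, Complex.norm_real, Real.norm_eq_abs,
      abs_of_nonneg]
    rw [Real.tanh_eq_sinh_div_cosh]
    exact div_nonneg (Real.sinh_nonneg_iff.2 (by positivity)) (Real.cosh_pos _).le
  have hc := Real.cosh_pos (r / 2)
  have h1 : 1 - Real.tanh (r / 2) ^ 2 = (1 / Real.cosh (r / 2)) ^ 2 := by
    rw [Real.tanh_eq_sinh_div_cosh]
    field_simp
    linarith [Real.cosh_sq (r / 2)]
  have h2 : Real.tanh (r / 2) / √(1 - Real.tanh (r / 2) ^ 2) = Real.sinh (r / 2) := by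
    rw [h1, Real.sqrt_sq (by positivity), Real.tanh_eq_sinh_div_cosh]
    field_simp
  simp only [radius, hypDist, Complex.UnitDisc.coe_zero, sub_zero, norm_zero, hw]
  norm_num
  rw [h2, Real.arsinh_sinh]
  ring

theorem measurable_radius : Measurable radius := by
  have : Measurable fun w : Complex.UnitDisc => (w : ℂ) :=
    Complex.UnitDisc.continuous_coe.measurable
  have h : Measurable fun x : ℝ => Real.arsinh x := Real.continuous_arsinh.measurable
  unfold radius hypDist
  fun_prop

theorem measurable_ofPolar : Measurable ofPolar := by
  have h : Continuous fun p : ℝ × ℝ => (Real.tanh (p.1 / 2) * Complex.exp (p.2 * Complex.I) : ℂ) := by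
    have : Continuous fun x : ℝ => Real.tanh x := by
      simp_rw [Real.tanh_eq_sinh_div_cosh]
      exact Real.continuous_sinh.div Real.continuous_cosh fun x => (Real.cosh_pos x).ne'
    fun_prop
  refine Continuous.measurable ?_
  rw [Complex.UnitDisc.isEmbedding_coe.continuous_iff]
  exact h

theorem measurable_radialDensity (α ν : ℝ) (n : ℕ) : Measurable (radialDensity α ν n) := by
  unfold radialDensity
  refine Measurable.ite ?_ (by fun_prop) measurable_const
  exact measurableSet_Ici.inter measurableSet_Iio

theorem radialDensity_nonneg {α : ℝ} (hα : 0 < α) (ν : ℝ) (n : ℕ) (r : ℝ) :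
    0 ≤ radialDensity α ν n r := by
  unfold radialDensity
  split_ifs with h
  · exact div_nonneg (mul_nonneg hα.le (Real.sinh_nonneg_iff.2 (mul_nonneg hα.le h.1)))
      (sub_nonneg.2 (Real.one_le_cosh _))
  · exact le_rfl

/-- The density lives on `r ≥ 0`, where `radius ∘ ofPolar` is the first projection; the angular
factor has mass `1` and integrates out. -/
theorem map_radius_nodeMeasure (α ν : ℝ) (n : ℕ) :
    (nodeMeasure α ν n).map radius =
      (volume : Measure ℝ).withDensity fun r => ENNReal.ofReal (radialDensity α ν n r) := by
  set A : Measure ℝ := volume.withDensity fun r => ENNReal.ofReal (radialDensity α ν n r) with hA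
  have hπ : (volume : Measure ℝ) (Set.Ioc (-Real.pi) Real.pi) ≠ 0 := by
    simp [Real.volume_Ioc, Real.pi_pos]
  have hB : IsProbabilityMeasure (cond (volume : Measure ℝ) (Set.Ioc (-Real.pi) Real.pi)) :=
    cond_isProbabilityMeasure_of_finite hπ (by simp [Real.volume_Ioc])
  have hae : ∀ᵐ r ∂A, 0 ≤ r := by
    rw [hA, ae_withDensity_iff (measurable_radialDensity α ν n).ennreal_ofReal]
    refine ae_of_all _ fun r hr => ?_
    by_contra h
    simp [radialDensity, h] at hr
  rw [nodeMeasure, Measure.map_map measurable_radius measurable_ofPolar]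
  have hcongr : radius ∘ ofPolar =ᵐ[A.prod (cond volume (Set.Ioc (-Real.pi) Real.pi))] Prod.fst := by
    filter_upwards [Measure.quasiMeasurePreserving_fst.ae hae] with p hp
    exact radius_ofPolar hp p.2
  rw [Measure.map_congr hcongr]
  change (A.prod _).fst = A
  exact Measure.fst_prod

/-- The density, with respect to Lebesgue measure, of `n` times the law of `c r - b`. -/
noncomputable def affineDensity (α ν : ℝ) (n : ℕ) (c b u : ℝ) : ℝ :=
  n * (radialDensity α ν n ((u + b) / c) / c)

theorem integral_nodeMeasure {α : ℝ} (hα : 0 < α) (ν : ℝ) (n : ℕ) {c : ℝ} (hc : 0 < c) (b : ℝ)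
    {H : ℝ → ℂ} (hH : Measurable H) :
    (n : ℂ) * ∫ w, H (c * radius w - b) ∂nodeMeasure α ν n =
      ∫ u, H u * (affineDensity α ν n c b u : ℝ) := by
  have h1 : ∫ w, H (c * radius w - b) ∂nodeMeasure α ν n =
      ∫ r, H (c * r - b) * (radialDensity α ν n r : ℝ) := by
    rw [← integral_map (φ := radius) (f := fun r => H (c * r - b)) measurable_radius.aemeasurable
      (hH.comp (by fun_prop)).aestronglyMeasurable, map_radius_nodeMeasure,
      integral_withDensity_eq_integral_toReal_smul
        (measurable_radialDensity α ν n).ennreal_ofReal (by simp)]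
    congr 1 with r
    rw [ENNReal.toReal_ofReal (radialDensity_nonneg hα ν n r), Complex.real_smul, mul_comm]
  have h2 := Measure.integral_comp_mul_left
    (fun v => H (v - b) * (radialDensity α ν n (v / c) : ℝ)) c
  simp only [mul_div_cancel_left₀ _ hc.ne'] at h2
  rw [h1, h2, ← integral_add_right_eq_self _ b, abs_of_pos (inv_pos.2 hc), ← integral_smul,
    ← integral_const_mul]
  congr 1 with u
  simp only [affineDensity, add_sub_cancel_right, Complex.real_smul]
  push_cast
  ring

/-! ### Asymptotics of the normalization and vague convergence -/

section Asymptotics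

variable {α ν : ℝ}

theorem tendsto_diskRadius (hν : 0 < ν) : Tendsto (diskRadius ν) atTop atTop := by
  unfold diskRadius
  exact (Real.tendsto_log_atTop.comp
    (tendsto_natCast_atTop_atTop.atTop_div_const hν)).const_mul_atTop two_pos

theorem natCast_eq_exp_diskRadius (hν : 0 < ν) {n : ℕ} (hn : 0 < n) :
    (n : ℝ) = ν * Real.exp (diskRadius ν n / 2) := by
  have : (0 : ℝ) < n / ν := by positivity
  rw [diskRadius, mul_div_cancel_left₀ _ two_ne_zero, Real.exp_log this]
  field_simp

/-- The normalized inverse of the normalization constant of the density. -/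
noncomputable def normalization (α R : ℝ) : ℝ := Real.exp (α * R) / (Real.cosh (α * R) - 1)

/-- With `x = e^{αR}`, the normalization equals `2 / (1 - x⁻¹)²`. -/
theorem tendsto_normalization (hα : 0 < α) (hν : 0 < ν) :
    Tendsto (fun n => normalization α (diskRadius ν n)) atTop (𝓝 2) := by
  have h0 : Tendsto (fun n => Real.exp (-(α * diskRadius ν n))) atTop (𝓝 0) :=
    Real.tendsto_exp_neg_atTop_nhds_zero.comp ((tendsto_diskRadius hν).const_mul_atTop hα)
  have h1 := ((tendsto_const_nhds (x := (1 : ℝ))).sub h0).pow 2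
  have h2 := (tendsto_const_nhds (x := (2 : ℝ))).div h1 (by norm_num)
  norm_num at h2
  refine h2.congr fun n => ?_
  unfold normalization
  simp only [Pi.div_apply]
  rw [Real.cosh_eq, Real.exp_neg]
  set x := Real.exp (α * diskRadius ν n)
  have hx : 0 < x := Real.exp_pos _
  -- Here `R = 0`, and both sides are `0` by the convention for division by zero.
  by_cases h : x = 1
  · simp [h]
  · have h1 : x - 1 ≠ 0 := sub_ne_zero.2 h
    have e1 : (1 - x⁻¹) = (x - 1) / x := by field_simp
    have e2 : (x + x⁻¹) / 2 - 1 = (x - 1) ^ 2 / (2 * x) := by field_simp; ring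
    rw [e1, e2]
    field_simp

theorem normalization_nonneg (α R : ℝ) : 0 ≤ normalization α R :=
  div_nonneg (Real.exp_pos _).le (sub_nonneg.2 (Real.one_le_cosh _))

/-- Vague convergence of the rescaled laws from locally dominated convergence of the densities. -/
theorem tendsto_integral_nodeMeasure (hα : 0 < α) {c b : ℕ → ℝ}
    (hc : ∀ᶠ n in atTop, 0 < c n) {H : ℝ → ℂ} (hH : Measurable H) {γ G : ℝ → ℝ}
    (hG : Integrable G)
    (hbound : ∀ᶠ n in atTop, ∀ u, ‖H u * (affineDensity α ν n (c n) (b n) u : ℝ)‖ ≤ G u)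
    (hlim : ∀ u, Tendsto (fun n => affineDensity α ν n (c n) (b n) u) atTop (𝓝 (γ u))) :
    Tendsto (fun n : ℕ => (n : ℂ) * ∫ w, H (c n * radius w - b n) ∂nodeMeasure α ν n) atTop
      (𝓝 (∫ u, H u * (γ u : ℝ))) := by
  have hmeas : ∀ n, Measurable (affineDensity α ν n (c n) (b n)) := fun n =>
    (((measurable_radialDensity α ν n).comp (by fun_prop)).div_const _).const_mul _
  have := tendsto_integral_filter_of_dominated_convergence G
    (F := fun (n : ℕ) u => H u * (affineDensity α ν n (c n) (b n) u : ℝ))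
    (f := fun u => H u * (γ u : ℝ)) (l := atTop) (μ := volume)
    (Eventually.of_forall fun n =>
      (hH.mul (Complex.measurable_ofReal.comp (hmeas n))).aestronglyMeasurable)
    (hbound.mono fun n hn => ae_of_all _ hn) hG
    (ae_of_all _ fun u => tendsto_const_nhds.mul
      ((Complex.continuous_ofReal.tendsto _).comp (hlim u)))
  refine this.congr' ?_
  filter_upwards [hc] with n hn
  exact (integral_nodeMeasure hα ν n hn (b n) hH).symm

end Asymptotics

end RandomHyperbolicGraph

/-! ### The regime `α ≤ 1/2` -/

namespace RandomHyperbolicGraph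

/-- Of the two factors `c = n^{1/2-α}`, one cancels the Jacobian `1/c` and the other multiplies
`sinh (αu/c)`. -/
theorem natCast_eq_rpow_mul_exp_diskRadius {α ν : ℝ} (hν : 0 < ν) {n : ℕ} (hn : 0 < n) :
    (n : ℝ) = ν ^ (2 * α) * Real.exp (α * diskRadius ν n) * ((n : ℝ) ^ (1 / 2 - α)) ^ 2 := by
  have hn' : (0 : ℝ) < n := Nat.cast_pos.2 hn
  have h1 : Real.exp (α * diskRadius ν n) = (n / ν) ^ (2 * α) := by
    rw [Real.rpow_def_of_pos (by positivity), diskRadius]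
    ring_nf
  rw [h1, ← Real.mul_rpow hν.le (by positivity), mul_div_cancel₀ _ hν.ne', ← Real.rpow_natCast,
    ← Real.rpow_mul hn'.le, ← Real.rpow_add hn']
  conv_lhs => rw [← Real.rpow_one (n : ℝ)]
  congr 1
  push_cast
  ring

/-- The linear factor makes `c sinh (αu/c)` bounded uniformly in `c ≥ 1`, for `u ≥ 0`. -/
theorem sinh_le_mul_exp {x : ℝ} : Real.sinh x ≤ x * Real.exp x := by
  have h1 := Real.add_one_le_exp (-(2 * x))
  have h2 : Real.exp (-(2 * x)) * Real.exp x = Real.exp (-x) := by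
    rw [← Real.exp_add]; ring_nf
  rw [Real.sinh_eq]
  nlinarith [Real.exp_pos x]

section LowExponent

variable {α ν : ℝ}

theorem affineDensity_eq_of_mem (hν : 0 < ν) {n : ℕ} (hn : 0 < n) {u : ℝ} (hu : 0 ≤ u)
    (hR : u / (n : ℝ) ^ (1 / 2 - α) < diskRadius ν n) :
    affineDensity α ν n ((n : ℝ) ^ (1 / 2 - α)) 0 u =
      ν ^ (2 * α) * α * normalization α (diskRadius ν n) *
        ((n : ℝ) ^ (1 / 2 - α) * Real.sinh (α * (u / (n : ℝ) ^ (1 / 2 - α)))) := by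
  have hkey := natCast_eq_rpow_mul_exp_diskRadius (α := α) hν hn
  have hn' : (0 : ℝ) < n := Nat.cast_pos.2 hn
  have hc : 0 < (n : ℝ) ^ (1 / 2 - α) := Real.rpow_pos_of_pos hn' _
  rw [affineDensity, radialDensity, add_zero, if_pos ⟨by positivity, hR⟩, normalization]
  generalize (n : ℝ) ^ (1 / 2 - α) = c at *
  generalize Real.sinh (α * (u / c)) = s
  rw [hkey]
  simp only [div_eq_mul_inv]
  have hcc : c * c⁻¹ = 1 := mul_inv_cancel₀ hc.ne'
  linear_combination (ν ^ (2 * α) * Real.exp (α * diskRadius ν n) * α * s *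
    (Real.cosh (α * diskRadius ν n) - 1)⁻¹ * c) * hcc

theorem affineDensity_eq_zero_of_neg {n : ℕ} {c : ℝ} (hc : 0 < c) {u : ℝ} (hu : u < 0) :
    affineDensity α ν n c 0 u = 0 := by
  have : ¬ 0 ≤ u / c := not_le.2 (div_neg_of_neg_of_pos hu hc)
  simp [affineDensity, radialDensity, this]

theorem affineDensity_nonneg (hα : 0 < α) {n : ℕ} {c : ℝ} (hc : 0 < c) (b u : ℝ) :
    0 ≤ affineDensity α ν n c b u :=
  mul_nonneg (Nat.cast_nonneg n) (div_nonneg (radialDensity_nonneg hα ν n _) hc.le)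

theorem affineDensity_le (hα : 0 < α) (hα' : α ≤ 1 / 2) (hν : 0 < ν) {n : ℕ} (hn : 0 < n) {u : ℝ}
    (hu : 0 ≤ u) :
    affineDensity α ν n ((n : ℝ) ^ (1 / 2 - α)) 0 u ≤
      ν ^ (2 * α) * α * normalization α (diskRadius ν n) * (α * u * Real.exp (α * u)) := by
  have hνα : 0 < ν ^ (2 * α) := Real.rpow_pos_of_pos hν _
  have hN := normalization_nonneg α (diskRadius ν n)
  have hc : 1 ≤ (n : ℝ) ^ (1 / 2 - α) :=
    Real.one_le_rpow (by exact_mod_cast hn) (by linarith)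
  by_cases hR : u / (n : ℝ) ^ (1 / 2 - α) < diskRadius ν n
  · rw [affineDensity_eq_of_mem hν hn hu hR]
    generalize (n : ℝ) ^ (1 / 2 - α) = c at *
    have hc0 : 0 < c := by linarith
    refine mul_le_mul_of_nonneg_left ?_ (by positivity)
    calc c * Real.sinh (α * (u / c)) ≤ c * (α * (u / c) * Real.exp (α * (u / c))) := by
          gcongr; exact sinh_le_mul_exp
      _ = α * u * Real.exp (α * (u / c)) := by field_simp
      _ ≤ α * u * Real.exp (α * u) := by
          gcongr
          exact div_le_self hu hc
  · have : affineDensity α ν n ((n : ℝ) ^ (1 / 2 - α)) 0 u = 0 := by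
      rw [affineDensity, radialDensity, if_neg fun h => hR (by simpa using h.2)]
      simp
    rw [this]
    positivity

theorem tendsto_affineDensity (hα : 0 < α) (hα' : α ≤ 1 / 2) (hν : 0 < ν) {γ : ℝ → ℝ}
    (hγ : ∀ u, 0 ≤ u → Tendsto (fun n : ℕ => ν ^ (2 * α) * α * 2 *
      ((n : ℝ) ^ (1 / 2 - α) * Real.sinh (α * (u / (n : ℝ) ^ (1 / 2 - α))))) atTop (𝓝 (γ u)))
    (u : ℝ) :
    Tendsto (fun n : ℕ => affineDensity α ν n ((n : ℝ) ^ (1 / 2 - α)) 0 u) atTop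
      (𝓝 ((Set.Ici 0).indicator γ u)) := by
  have hpos : ∀ᶠ n : ℕ in atTop, 0 < n := eventually_gt_atTop 0
  by_cases hu : 0 ≤ u
  · rw [Set.indicator_of_mem (Set.mem_Ici.2 hu)]
    -- In `hγ` the normalization is replaced by its limit `2`; the correcting factor tends to `1`.
    have h1 := (hγ u hu).mul ((tendsto_normalization hα hν).div_const 2)
    norm_num at h1
    refine h1.congr' ?_
    filter_upwards [hpos, (tendsto_diskRadius hν).eventually_gt_atTop u] with n hn hR
    have hc : 1 ≤ (n : ℝ) ^ (1 / 2 - α) :=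
      Real.one_le_rpow (by exact_mod_cast hn) (by linarith)
    rw [affineDensity_eq_of_mem hν hn hu ((div_le_self hu hc).trans_lt hR)]
    ring_nf
  · rw [Set.indicator_of_notMem (by simpa using hu)]
    refine tendsto_const_nhds.congr' ?_
    filter_upwards [hpos] with n hn
    exact (affineDensity_eq_zero_of_neg (Real.rpow_pos_of_pos (Nat.cast_pos.2 hn) _)
      (not_le.1 hu)).symm

theorem integral_intensityIci {γ : ℝ → ℝ} (hγ : Measurable γ) (hγ0 : ∀ u, 0 ≤ u → 0 ≤ γ u)
    {H : ℝ → ℂ} :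
    ∫ x : Set.Ici (0 : ℝ), H x ∂intensityIci γ =
      ∫ u, H u * ((Set.Ici 0).indicator γ u : ℝ) := by
  have hm : Measurable fun u : Set.Ici (0 : ℝ) => ENNReal.ofReal (γ u) :=
    (hγ.comp measurable_subtype_coe).ennreal_ofReal
  rw [intensityIci, integral_withDensity_eq_integral_toReal_smul hm (by simp),
    integral_subtype_comap measurableSet_Ici
      (fun u => (ENNReal.ofReal (γ u)).toReal • H u), ← integral_indicator measurableSet_Ici]
  congr 1 with u
  by_cases hu : 0 ≤ u
  · simp [Set.indicator_of_mem (Set.mem_Ici.2 hu), ENNReal.toReal_ofReal (hγ0 u hu), mul_comm]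
  · simp [Set.indicator_of_notMem (s := Set.Ici (0 : ℝ)) (by simpa using hu)]

theorem isFiniteMeasureOnCompacts_intensityIci {γ : ℝ → ℝ} (hγ : Continuous γ) :
    IsFiniteMeasureOnCompacts (intensityIci γ) := by
  have : LocallyCompactSpace (Set.Ici (0 : ℝ)) := isClosed_Ici.locallyCompactSpace
  have : IsFiniteMeasureOnCompacts ((volume : Measure ℝ).comap (Subtype.val : Set.Ici (0 : ℝ) → ℝ)) :=
    IsFiniteMeasureOnCompacts.comap' _ continuous_subtype_val
      (MeasurableEmbedding.subtype_coe measurableSet_Ici)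
  have : IsLocallyFiniteMeasure ((volume : Measure ℝ).comap (Subtype.val : Set.Ici (0 : ℝ) → ℝ)) :=
    isLocallyFiniteMeasure_of_isFiniteMeasureOnCompacts
  have : IsLocallyFiniteMeasure (intensityIci γ) :=
    IsLocallyFiniteMeasure.withDensity_ofReal (f := fun u : Set.Ici (0 : ℝ) => γ u)
      (hγ.comp continuous_subtype_val)
  infer_instance

theorem tendsto_integral_map_Ici (hα : 0 < α) (hα' : α ≤ 1 / 2) (hν : 0 < ν) {γ : ℝ → ℝ}
    (hγm : Measurable γ) (hγ0 : ∀ u, 0 ≤ u → 0 ≤ γ u)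
    (hγ : ∀ u, 0 ≤ u → Tendsto (fun n : ℕ => ν ^ (2 * α) * α * 2 *
      ((n : ℝ) ^ (1 / 2 - α) * Real.sinh (α * (u / (n : ℝ) ^ (1 / 2 - α))))) atTop (𝓝 (γ u)))
    {h : Set.Ici (0 : ℝ) → ℂ} (hh : Continuous h) (hhc : HasCompactSupport h) :
    Tendsto (fun n : ℕ => (n : ℂ) * ∫ w, h ⟨(n : ℝ) ^ (1 / 2 - α) * radius w,
      mul_nonneg (by positivity) (radius_nonneg w)⟩ ∂nodeMeasure α ν n) atTop
      (𝓝 (∫ x, h x ∂intensityIci γ)) := by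
  -- A continuous extension to `ℝ`; its values at negative `u` are irrelevant, the densities
  -- vanishing there.
  let H : ℝ → ℂ := fun u => h ⟨max u 0, le_max_right u 0⟩
  have hH : Continuous H := hh.comp (by fun_prop)
  have hHh : ∀ (u : ℝ) (hu : 0 ≤ u), H u = h ⟨u, hu⟩ := fun u hu => by simp [H, max_eq_left hu]
  obtain ⟨M, hM⟩ := hhc.exists_bound_of_continuous hh
  obtain ⟨A, hA⟩ := (hhc.isCompact.image continuous_subtype_val).bddAbove
  have hHA : ∀ u, A < u → 0 ≤ u → H u = 0 := by
    intro u hu hu0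
    rw [hHh u hu0]
    refine image_eq_zero_of_notMem_tsupport fun hmem => ?_
    exact not_le.2 hu (hA ⟨_, hmem, rfl⟩)
  have hM0 : 0 ≤ M := (norm_nonneg _).trans (hM ⟨0, Set.mem_Ici.2 le_rfl⟩)
  -- The `3` is any bound above the limit `2` of the normalization.
  let g : ℝ → ℝ := fun u => M * (ν ^ (2 * α) * α * 3 * (α * u * Real.exp (α * u)))
  have hpos : ∀ᶠ n : ℕ in atTop, 0 < n := eventually_gt_atTop 0
  have key := tendsto_integral_nodeMeasure (ν := ν) hα (c := fun n : ℕ => (n : ℝ) ^ (1 / 2 - α))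
    (b := fun _ => 0) (G := (Set.Icc 0 A).indicator g)
    (hpos.mono fun n hn => Real.rpow_pos_of_pos (Nat.cast_pos.2 hn) _) hH.measurable
    ((integrable_indicator_iff measurableSet_Icc).2
      (Continuous.integrableOn_Icc (by fun_prop))) ?_ (tendsto_affineDensity hα hα' hν hγ)
  · have h1 : ∫ x, h x ∂intensityIci γ = ∫ u, H u * ((Set.Ici 0).indicator γ u : ℝ) := by
      rw [← integral_intensityIci hγm hγ0]
      congr 1 with x
      exact (hHh x x.2).symm
    rw [h1]
    refine key.congr fun n => ?_
    congr 2 with w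
    rw [sub_zero]
    exact hHh _ _
  · filter_upwards [hpos, (tendsto_normalization hα hν).eventually_le_const (u := 3) (by norm_num)]
      with n hn hN u
    have hc : 0 < (n : ℝ) ^ (1 / 2 - α) := Real.rpow_pos_of_pos (Nat.cast_pos.2 hn) _
    by_cases hu : 0 ≤ u
    · by_cases huA : u ≤ A
      · rw [Set.indicator_of_mem (Set.mem_Icc.2 ⟨hu, huA⟩), norm_mul, Complex.norm_real,
          Real.norm_of_nonneg (affineDensity_nonneg hα hc _ _)]
        have hνα : 0 < ν ^ (2 * α) := Real.rpow_pos_of_pos hν _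
        refine mul_le_mul (hM _) ((affineDensity_le hα hα' hν hn hu).trans ?_)
          (affineDensity_nonneg hα hc _ _) hM0
        gcongr
      · rw [hHA u (not_le.1 huA) hu, zero_mul, norm_zero,
          Set.indicator_of_notMem fun h => huA h.2]
    · rw [affineDensity_eq_zero_of_neg hc (not_le.1 hu), Set.indicator_of_notMem]
      · simp
      · exact fun h => hu h.1

end LowExponent

/-! ### The regime `α > 1/2` -/

section HighExponent

variable {α ν : ℝ}

/-- The shift `b` satisfies `R/2 + αb = αR`, so the growing exponential of `sinh` loses its
dependence on `R` against the normalization; the other keeps a factor `e^{-(2α-1)R}`. -/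
theorem affineDensity_eq_exp (hα : 0 < α) (hν : 0 < ν) {n : ℕ} (hn : 0 < n) {u : ℝ}
    (h0 : 0 ≤ u + (1 - 1 / (2 * α)) * diskRadius ν n)
    (hR : u + (1 - 1 / (2 * α)) * diskRadius ν n < diskRadius ν n) :
    affineDensity α ν n 1 ((1 - 1 / (2 * α)) * diskRadius ν n) u =
      α * ν * normalization α (diskRadius ν n) *
        ((Real.exp (α * u) - Real.exp (-(α * u) - (2 * α - 1) * diskRadius ν n)) / 2) := by
  have hkey := natCast_eq_exp_diskRadius hν hn
  rw [affineDensity, radialDensity, div_one, div_one, if_pos ⟨h0, hR⟩, normalization, hkey,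
    Real.sinh_eq]
  generalize diskRadius ν n = R
  have e1 : Real.exp (R / 2) * Real.exp (α * (u + (1 - 1 / (2 * α)) * R)) =
      Real.exp (α * R) * Real.exp (α * u) := by
    rw [← Real.exp_add, ← Real.exp_add]
    congr 1
    field_simp
    ring
  have e2 : Real.exp (R / 2) * Real.exp (-(α * (u + (1 - 1 / (2 * α)) * R))) =
      Real.exp (α * R) * Real.exp (-(α * u) - (2 * α - 1) * R) := by
    rw [← Real.exp_add, ← Real.exp_add]
    congr 1
    field_simp
    ring
  simp only [div_eq_mul_inv] at e1 e2 ⊢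
  linear_combination (ν * α * (Real.cosh (α * R) - 1)⁻¹ / 2) * (e1 - e2)

theorem affineDensity_le_exp (hα : 0 < α) (hν : 0 < ν) {n : ℕ} (hn : 0 < n) (u : ℝ) :
    affineDensity α ν n 1 ((1 - 1 / (2 * α)) * diskRadius ν n) u ≤
      α * ν * normalization α (diskRadius ν n) * Real.exp (α * u) := by
  have hN := normalization_nonneg α (diskRadius ν n)
  by_cases h : 0 ≤ u + (1 - 1 / (2 * α)) * diskRadius ν n ∧
      u + (1 - 1 / (2 * α)) * diskRadius ν n < diskRadius ν n
  · rw [affineDensity_eq_exp hα hν hn h.1 h.2]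
    gcongr
    linarith [Real.exp_pos (α * u), Real.exp_pos (-(α * u) - (2 * α - 1) * diskRadius ν n)]
  · have : affineDensity α ν n 1 ((1 - 1 / (2 * α)) * diskRadius ν n) u = 0 := by
      rw [affineDensity, radialDensity, div_one, div_one, if_neg h]
      simp
    rw [this]
    positivity

theorem tendsto_affineDensity_exp (hα : 1 / 2 < α) (hν : 0 < ν) (u : ℝ) :
    Tendsto (fun n : ℕ => affineDensity α ν n 1 ((1 - 1 / (2 * α)) * diskRadius ν n) u) atTop
      (𝓝 (α * ν * Real.exp (α * u))) := by
  have hα0 : 0 < α := by linarith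
  have hR := tendsto_diskRadius hν
  have h1 : 0 < 1 - 1 / (2 * α) := by
    rw [sub_pos, div_lt_one (by positivity)]
    linarith
  have h2 : 0 < 1 / (2 * α) := by positivity
  have hexp : Tendsto (fun n => Real.exp (-(α * u) - (2 * α - 1) * diskRadius ν n)) atTop (𝓝 0) := by
    refine Real.tendsto_exp_atBot.comp ?_
    simp only [sub_eq_add_neg (-(α * u))]
    exact tendsto_atBot_add_const_left _ _
      (tendsto_neg_atTop_atBot.comp (hR.const_mul_atTop (by linarith)))
  have h3 := ((tendsto_normalization hα0 hν).const_mul (α * ν)).mul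
    ((hexp.const_sub (Real.exp (α * u))).div_const 2)
  have e : α * ν * 2 * ((Real.exp (α * u) - 0) / 2) = α * ν * Real.exp (α * u) := by ring
  rw [e] at h3
  refine h3.congr' ?_
  -- Both ends of the support of the shifted density recede to infinity, so `u` is eventually
  -- inside.
  filter_upwards [eventually_gt_atTop 0, (hR.const_mul_atTop h1).eventually_ge_atTop (-u),
    (hR.const_mul_atTop h2).eventually_gt_atTop u] with n hn hn1 hn2
  exact (affineDensity_eq_exp hα0 hν hn (by linarith) (by linarith)).symm

theorem continuous_toIio : Continuous toIio :=
  continuous_coe_real_ereal.subtype_mk _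

theorem integral_intensityIio {γ : ℝ → ℝ} (hγ : Measurable γ) (hγ0 : ∀ u, 0 ≤ γ u)
    {h : Set.Iio (⊤ : EReal) → ℂ} (hh : Continuous h) :
    ∫ x, h x ∂intensityIio γ = ∫ u, h (toIio u) * (γ u : ℝ) := by
  rw [intensityIio, integral_map continuous_toIio.measurable.aemeasurable
    hh.measurable.aestronglyMeasurable,
    integral_withDensity_eq_integral_toReal_smul hγ.ennreal_ofReal (by simp)]
  congr 1 with u
  rw [ENNReal.toReal_ofReal (hγ0 u), Complex.real_smul, mul_comm]

/-- Compact sets stay away from `⊤` but may contain `-∞`, so there is only an upper cutoff, and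
majorants must be integrable on `(-∞, A]`. -/
theorem exists_le_of_isCompact_Iio {K : Set (Set.Iio (⊤ : EReal))} (hK : IsCompact K) :
    ∃ A : ℝ, ∀ u, toIio u ∈ K → u ≤ A := by
  by_cases hne : K.Nonempty
  · obtain ⟨x, -, hx⟩ := hK.exists_isMaxOn hne continuous_subtype_val.continuousOn
    obtain ⟨A, hA, -⟩ := EReal.lt_iff_exists_real_btwn.1 x.2
    refine ⟨A, fun u hu => ?_⟩
    have h1 : (u : EReal) ≤ x := hx hu
    exact_mod_cast h1.trans hA.le
  · exact ⟨0, fun u hu => (hne ⟨_, hu⟩).elim⟩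

theorem isFiniteMeasureOnCompacts_intensityIio {γ : ℝ → ℝ}
    (hγ : ∀ A : ℝ, IntegrableOn γ (Set.Iic A)) : IsFiniteMeasureOnCompacts (intensityIio γ) := by
  refine ⟨fun K hK => ?_⟩
  obtain ⟨A, hA⟩ := exists_le_of_isCompact_Iio hK
  rw [intensityIio, Measure.map_apply continuous_toIio.measurable hK.measurableSet]
  have hsub : toIio ⁻¹' K ⊆ Set.Iic A := fun u hu => hA u hu
  refine (measure_mono hsub).trans_lt ?_
  rw [withDensity_apply _ measurableSet_Iic]
  exact (hγ A).lintegral_lt_top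

theorem tendsto_integral_map_Iio (hα : 1 / 2 < α) (hν : 0 < ν)
    {h : Set.Iio (⊤ : EReal) → ℂ} (hh : Continuous h) (hhc : HasCompactSupport h) :
    Tendsto (fun n : ℕ => (n : ℂ) * ∫ w, h (toIio (radius w -
      (1 - 1 / (2 * α)) * diskRadius ν n)) ∂nodeMeasure α ν n) atTop
      (𝓝 (∫ x, h x ∂intensityIio fun u => α * ν * Real.exp (α * u))) := by
  have hα0 : 0 < α := by linarith
  obtain ⟨M, hM⟩ := hhc.exists_bound_of_continuous hh
  obtain ⟨A, hA⟩ := exists_le_of_isCompact_Iio hhc.isCompact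
  have hHA : ∀ u, A < u → h (toIio u) = 0 := fun u hu =>
    image_eq_zero_of_notMem_tsupport fun hmem => not_le.2 hu (hA u hmem)
  have hM0 : 0 ≤ M := (norm_nonneg _).trans (hM (toIio 0))
  let g : ℝ → ℝ := fun u => M * (α * ν * 3) * Real.exp (α * u)
  have hg : Integrable ((Set.Iic A).indicator g) :=
    (integrable_indicator_iff measurableSet_Iic).2 ((integrableOn_exp_mul_Iic hα0 A).const_mul _)
  have key := tendsto_integral_nodeMeasure (ν := ν) hα0 (c := fun _ => 1)
    (b := fun n => (1 - 1 / (2 * α)) * diskRadius ν n) (Eventually.of_forall fun _ => one_pos)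
    (hh.comp continuous_toIio).measurable hg ?_ (tendsto_affineDensity_exp hα hν)
  · rw [integral_intensityIio (by fun_prop) (fun u => by positivity) hh]
    simpa using key
  · filter_upwards [eventually_gt_atTop 0,
      (tendsto_normalization hα0 hν).eventually_le_const (u := 3) (by norm_num)] with n hn hN u
    by_cases huA : u ≤ A
    · rw [Set.indicator_of_mem (Set.mem_Iic.2 huA), norm_mul, Complex.norm_real,
        Real.norm_of_nonneg (affineDensity_nonneg hα0 one_pos _ _)]
      simp only [g, mul_assoc M]
      refine mul_le_mul (hM _) ((affineDensity_le_exp hα0 hν hn u).trans ?_)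
        (affineDensity_nonneg hα0 one_pos _ _) hM0
      gcongr
    · rw [Function.comp_apply, hHA u (not_le.1 huA), zero_mul, norm_zero, Set.indicator_of_notMem]
      simpa using huA

end HighExponent

end RandomHyperbolicGraph

/-- The Poisson limit theorem for the images of independent points under maps `T n`. -/
theorem tendstoInDistributionPoisson_ofPoints {E S : Type*} [TopologicalSpace E]
    [MeasurableSpace E] [T2Space E] [LocallyCompactSpace E] [SecondCountableTopology E]
    [BorelSpace E] [Nonempty E] [MeasurableSpace S]
    {Ω : ℕ → Type*} [∀ n, MeasurableSpace (Ω n)]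
    {P : ∀ n, Measure (Ω n)} [∀ n, IsProbabilityMeasure (P n)]
    {Λ : Measure E} [IsFiniteMeasureOnCompacts Λ] {X : ∀ n, Fin n → Ω n → S}
    (hX : ∀ n i, AEMeasurable (X n i) (P n)) {μ : ℕ → Measure S}
    (hind : ∀ᶠ n in atTop, iIndepFun (X n) (P n))
    (hlaw : ∀ᶠ n in atTop, ∀ i, HasLaw (X n i) (μ n) (P n)) {T : ℕ → S → E}
    (hT : ∀ n, Measurable (T n))
    (hμ : ∀ h : E → ℂ, Continuous h → HasCompactSupport h →
      Tendsto (fun n : ℕ => (n : ℂ) * ∫ w, h (T n w) ∂μ n) atTop (𝓝 (∫ x, h x ∂Λ))) :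
    TendstoInDistributionPoisson (fun n ω => PointMeasure.ofPoints fun i => T n (X n i ω)) P Λ := by
  refine ⟨exists_isPoissonProcess Λ, fun Q hQ => ?_⟩
  refine tendstoInDistribution_ofPoints (Y := fun n i ω => T n (X n i ω))
    (μ := fun n => (μ n).map (T n)) (fun n i => (hT n).comp_aemeasurable (hX n i))
    (hind.mono fun n hn => hn.comp (fun _ => T n) fun _ => hT n)
    (hlaw.mono fun n hn i => ?_) (fun h hh hhc => (hμ h hh hhc).congr fun n => ?_) hQ
  · exact HasLaw.comp (X := X n i) (Y := T n) ⟨(hT n).aemeasurable, rfl⟩ (hn i)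
  · rw [integral_map (hT n).aemeasurable hh.measurable.aestronglyMeasurable]

/-! ### Assembling the three regimes -/

namespace RandomHyperbolicGraph

section

variable {α ν : ℝ} {Ω : ℕ → Type*} [∀ n, MeasurableSpace (Ω n)]
  {P : ∀ n, Measure (Ω n)} [∀ n, IsProbabilityMeasure (P n)]
  {X : ∀ n, Fin n → Ω n → Complex.UnitDisc}

/-- Leaving the pointwise limit as the hypothesis `hγ` lets `α < 1/2`, where the scale diverges, and
`α = 1/2`, where it is `1`, share one proof. -/
theorem tendstoInDistributionPoisson_radius_Ici (hα : 0 < α) (hα' : α ≤ 1 / 2) (hν : 0 < ν)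
    (hX : ∀ n i, AEMeasurable (X n i) (P n))
    (hindep : ∀ n : ℕ, ν < n → iIndepFun (X n) (P n))
    (hlaw : ∀ n : ℕ, ν < n → ∀ i, HasLaw (X n i) (nodeMeasure α ν n) (P n)) {γ : ℝ → ℝ}
    (hγc : Continuous γ) (hγ0 : ∀ u, 0 ≤ u → 0 ≤ γ u)
    (hγ : ∀ u, 0 ≤ u → Tendsto (fun n : ℕ => ν ^ (2 * α) * α * 2 *
      ((n : ℝ) ^ (1 / 2 - α) * Real.sinh (α * (u / (n : ℝ) ^ (1 / 2 - α))))) atTop (𝓝 (γ u))) :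
    TendstoInDistributionPoisson
      (fun n ω => PointMeasure.ofPoints (fun i : Fin n =>
        (⟨(n : ℝ) ^ (1 / 2 - α) * radius (X n i ω),
          mul_nonneg (by positivity) (radius_nonneg _)⟩ : Set.Ici (0 : ℝ)))) P
      (intensityIci γ) := by
  have : LocallyCompactSpace (Set.Ici (0 : ℝ)) := isClosed_Ici.locallyCompactSpace
  have := isFiniteMeasureOnCompacts_intensityIci hγc
  have hev : ∀ᶠ n : ℕ in atTop, ν < n := tendsto_natCast_atTop_atTop.eventually_gt_atTop ν
  refine tendstoInDistributionPoisson_ofPoints hX (hev.mono hindep) (hev.mono hlaw)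
    (T := fun n w => (⟨(n : ℝ) ^ (1 / 2 - α) * radius w,
      mul_nonneg (by positivity) (radius_nonneg w)⟩ : Set.Ici (0 : ℝ)))
    (fun n => (measurable_radius.const_mul _).subtype_mk) fun h hh hhc => ?_
  exact tendsto_integral_map_Ici hα hα' hν hγc.measurable hγ0 hγ hh hhc

/-- This is the difference quotient of `t ↦ sinh (a t)` at `0` along `t = 1 / c n`. -/
theorem tendsto_mul_sinh_div {a : ℝ} {c : ℕ → ℝ} (hc : Tendsto c atTop atTop) :
    Tendsto (fun n => c n * Real.sinh (a / c n)) atTop (𝓝 a) := by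
  have h1 : HasDerivAt (fun t => Real.sinh (a * t)) a 0 := by
    simpa using ((hasDerivAt_id (0 : ℝ)).const_mul a).sinh
  have h2 : Tendsto (fun n => (c n)⁻¹) atTop (𝓝[≠] 0) := by
    refine tendsto_nhdsWithin_iff.2 ⟨tendsto_inv_atTop_zero.comp hc, ?_⟩
    filter_upwards [hc.eventually_gt_atTop 0] with n hn
    exact inv_ne_zero hn.ne'
  have h3 := h1.tendsto_slope_zero.comp h2
  simpa [Function.comp_def, div_eq_mul_inv] using h3

end

end RandomHyperbolicGraph

theorem proposition4p1 (α ν : ℝ) (hα : 0 < α) (hν : 0 < ν)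
    {Ω : ℕ → Type*} [∀ n, MeasurableSpace (Ω n)]
    (P : ∀ n, Measure (Ω n)) [∀ n, IsProbabilityMeasure (P n)]
    (X : ∀ n, Fin n → Ω n → Complex.UnitDisc)
    (hX : ∀ n i, AEMeasurable (X n i) (P n))
    (hindep : ∀ n : ℕ, ν < n → iIndepFun (X n) (P n))
    (hlaw : ∀ n : ℕ, ν < n → ∀ i,
      HasLaw (X n i) (RandomHyperbolicGraph.nodeMeasure α ν n) (P n)) :
    (α < 1 / 2 →
      TendstoInDistributionPoisson
        (fun n ω => PointMeasure.ofPoints (fun i : Fin n =>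
          (⟨(n : ℝ) ^ (1 / 2 - α) * RandomHyperbolicGraph.radius (X n i ω),
            mul_nonneg (by positivity) (RandomHyperbolicGraph.radius_nonneg _)⟩ :
              Set.Ici (0 : ℝ))))
        P
        (RandomHyperbolicGraph.intensityIci (fun u => 2 * α ^ 2 * ν ^ (2 * α) * u))) ∧
    (α = 1 / 2 →
      TendstoInDistributionPoisson
        (fun n ω => PointMeasure.ofPoints (fun i : Fin n =>
          (⟨RandomHyperbolicGraph.radius (X n i ω), RandomHyperbolicGraph.radius_nonneg _⟩ :
            Set.Ici (0 : ℝ))))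
        P
        (RandomHyperbolicGraph.intensityIci (fun u => ν * Real.sinh (u / 2)))) ∧
    (1 / 2 < α →
      TendstoInDistributionPoisson
        (fun n ω => PointMeasure.ofPoints (fun i : Fin n =>
          RandomHyperbolicGraph.toIio (RandomHyperbolicGraph.radius (X n i ω) -
            (1 - 1 / (2 * α)) * RandomHyperbolicGraph.diskRadius ν n)))
        P
        (RandomHyperbolicGraph.intensityIio (fun u => α * ν * Real.exp (α * u)))) := by
  refine ⟨fun hlt => ?_, fun heq => ?_, fun hgt => ?_⟩
  · refine RandomHyperbolicGraph.tendstoInDistributionPoisson_radius_Ici hα hlt.le hν hX hindep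
      hlaw (by fun_prop) (fun u hu => by positivity) fun u _ => ?_
    have hc : Tendsto (fun n : ℕ => (n : ℝ) ^ (1 / 2 - α)) atTop atTop :=
      (tendsto_rpow_atTop (by linarith)).comp tendsto_natCast_atTop_atTop
    have h := (RandomHyperbolicGraph.tendsto_mul_sinh_div (a := α * u) hc).const_mul
      (ν ^ (2 * α) * α * 2)
    simp only [← mul_div_assoc]
    convert h using 2
    ring
  · have h := RandomHyperbolicGraph.tendstoInDistributionPoisson_radius_Ici hα heq.le hν hX hindep
      hlaw (γ := fun u => ν * Real.sinh (u / 2)) (by fun_prop)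
      (fun u hu => mul_nonneg hν.le (Real.sinh_nonneg_iff.2 (by positivity))) fun u _ => ?_
    · convert h using 6 with n ω i
      simp [heq]
    -- At `α = 1/2` the scale is `n ^ 0 = 1` and the sequence is constant.
    · refine tendsto_const_nhds.congr fun n => ?_
      rw [heq, sub_self, Real.rpow_zero]
      norm_num
      ring_nf
  · have : LocallyCompactSpace (Set.Iio (⊤ : EReal)) := isOpen_Iio.locallyCompactSpace
    have : Nonempty (Set.Iio (⊤ : EReal)) := ⟨RandomHyperbolicGraph.toIio 0⟩
    have := RandomHyperbolicGraph.isFiniteMeasureOnCompacts_intensityIio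
      (γ := fun u => α * ν * Real.exp (α * u))
      fun A => (integrableOn_exp_mul_Iic hα A).const_mul _
    have hev : ∀ᶠ n : ℕ in atTop, ν < n := tendsto_natCast_atTop_atTop.eventually_gt_atTop ν
    refine tendstoInDistributionPoisson_ofPoints hX (hev.mono hindep) (hev.mono hlaw)
      (T := fun n w => RandomHyperbolicGraph.toIio (RandomHyperbolicGraph.radius w -
        (1 - 1 / (2 * α)) * RandomHyperbolicGraph.diskRadius ν n))
      (fun n => RandomHyperbolicGraph.continuous_toIio.measurable.comp
        (RandomHyperbolicGraph.measurable_radius.sub_const _)) fun h hh hhc => ?_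
    exact RandomHyperbolicGraph.tendsto_integral_map_Iio hgt hν hh hhc
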